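/- \textbf{Corollary (Consistency of SDP-$2'$ for the strongly assortative case).} Let $K\ge 2$, $m\ge 1$, $n=mK$. Let the $n$ nodes be divided into $K$ consecutive blocks $S_1,\dots,S_K$ of size $m$, and let $X_0 = I_K\otimes E_m$ be the true cluster matrix, where $E_m$ is the $m\times m$ all-ones matrix. For a symmetric $\Psi\in[0,1]^{K\times K}$, a random symmetric matrix $A$ is drawn from the balanced block model $\mathrm{BM}^{\mathrm{bal}}_m(\Psi)$ if the entries $A_{ij}$, $i<j$, are independent Bernoulli variables with $\mathbb P(A_{ij}=1)=\Psi_{k\ell}$ for $i\in S_k$, $j\in S_\ell$ (the diagonal of $A$ is arbitrary). Put $p^- = \min_k \Psi_{kk}$ and $q^+=\max_{k\ne \ell}\Psi_{k\ell}$; the model is strongly assortative if $p^->q^+$. Write $\widetilde p = p^- m/\log n$ and $\widetilde q = q^+ m/\log n$. SDP-$2'$ with input $A$ is the problem of maximizing $\langle A,X\rangle=\operatorname{tr}(AX)$ over symmetric $n\times n$ matrices $X$ subject to $\langle E_n,X\rangle = n^2/K$, $\operatorname{diag}(X)=\mathbf 1_n$, $X\succeq 0$ and $X\ge 0$ entrywise;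 it is strongly consistent if its set of solutions is exactly $\{X_0\}$. There are universal constants $C,C',c,r>0$ such that the following holds. Let $A$ be drawn from a strongly assortative $\mathrm{BM}^{\mathrm{bal}}_m(\Psi)$. For any $c_1,c_2>0$, let $C_1 = \max\{C',\tfrac49(c_1+1)\}$ and $C_2 = C+\max\{\sqrt{4(c_1+1)},\,3\sqrt{4(c_2+1)}\}$. If $\widetilde p\ge C_1$ and $$\widetilde p-\widetilde q > C_2\bigl(\sqrt{\widetilde p}+\sqrt{\widetilde q\,K}\bigr),$$ then SDP-$2'$ is strongly consistent with probability at least $$1-c\,(K m^{-r}+n^{-r})-n^{-c_1}-2m^{-1}n^{-c_2}.$$ -/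

import Mathlib

open MeasureTheory ProbabilityTheory

noncomputable section

namespace BlockModel

/-- The `n = m K` nodes: `(k, a)` is the `a`-th node of community `k`. -/
abbrev Node (K m : ℕ) : Type := Fin K × Fin m

/-- The true cluster matrix `X₀ = I_K ⊗ E_m`. -/
def trueCluster (K m : ℕ) : Matrix (Node K m) (Node K m) ℝ :=
  Matrix.kronecker (1 : Matrix (Fin K) (Fin K) ℝ) (Matrix.of fun (_ _ : Fin m) => (1 : ℝ))

/-- A symmetric matrix of edge probabilities. -/
structure IsProbabilityMatrix {K : ℕ} (Ψ : Matrix (Fin K) (Fin K) ℝ) : Prop where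
  symm : Ψ.IsSymm
  mem_Icc : ∀ k l, Ψ k l ∈ Set.Icc (0 : ℝ) 1

/-- `p⁻ = min_k Ψ_kk`. -/
def pMinus {K : ℕ} (Ψ : Matrix (Fin K) (Fin K) ℝ) : ℝ :=
  ⨅ k : Fin K, Ψ k k

/-- `q⁺ = max_{k ≠ l} Ψ_kl` (a maximum over a nonempty finite set when `2 ≤ K`). -/
def qPlus {K : ℕ} (Ψ : Matrix (Fin K) (Fin K) ℝ) : ℝ :=
  ⨆ e : {e : Fin K × Fin K // e.1 ≠ e.2}, Ψ e.1.1 e.1.2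

/-- Strong assortativity: `min_k p_k > max_{k ≠ l} q_kl`. -/
def StronglyAssortative {K : ℕ} (Ψ : Matrix (Fin K) (Fin K) ℝ) : Prop :=
  qPlus Ψ < pMinus Ψ

/-- `A` is drawn from the balanced block model with `K` blocks of size `m` and edge probabilities
`Ψ`, given the true clusters: a symmetric random matrix whose entries `A_ij`, `i < j`, are
independent Bernoulli variables, with success probability `Ψ_kl` for `i` in block `k` and `j` in
block `l`. The nodes are numbered consecutively through the blocks (lexicographic order).
The diagonal entries are not part of the data and are left unconstrained. -/
structure IsBalancedBlockModel {K m : ℕ} {Ω : Type*} [MeasurableSpace Ω] (P : Measure Ω)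
    (Ψ : Matrix (Fin K) (Fin K) ℝ) (A : Ω → Matrix (Node K m) (Node K m) ℝ) : Prop where
  symm : ∀ ω, (A ω).IsSymm
  binary : ∀ ω i j, i ≠ j → A ω i j = 0 ∨ A ω i j = 1
  measurable : ∀ i j, i ≠ j → Measurable fun ω => A ω i j
  indep : iIndepFun
    (fun (e : {e : Node K m × Node K m // toLex e.1 < toLex e.2}) ω => A ω e.1.1 e.1.2) P
  prob : ∀ i j, i ≠ j → P.real {ω | A ω i j = 1} = Ψ i.1 j.1

/-- The feasible set of SDP-2': `⟨E_n, X⟩ = n² / K` with `n = m K`, `diag X = 1`, `X ⪰ 0` and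
`X ≥ 0` entrywise. -/
def sdp2Feasible (K m : ℕ) : Set (Matrix (Node K m) (Node K m) ℝ) :=
  {X | (Matrix.of (fun (_ _ : Node K m) => (1 : ℝ)) * X).trace = ((m : ℝ) * K) ^ 2 / K ∧
    X.diag = 1 ∧ X.PosSemidef ∧ ∀ i j, 0 ≤ X i j}

/-- The solution set of SDP-2' for the input `A`: the maximizers of `⟨A, X⟩ = tr (A X)` over the
feasible set. -/
def sdp2Solutions {K m : ℕ} (A : Matrix (Node K m) (Node K m) ℝ) :
    Set (Matrix (Node K m) (Node K m) ℝ) :=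
  {X | X ∈ sdp2Feasible K m ∧ ∀ Y ∈ sdp2Feasible K m, (A * Y).trace ≤ (A * X).trace}

/-- The rescaling `x ↦ x m / log n`, with `n = m K`. -/
def rescale (K m : ℕ) (x : ℝ) : ℝ :=
  x * m / Real.log ((m : ℝ) * K)

end BlockModel

end

/-! Write A = 𝔼A + W off the diagonal. The argument splits into a deterministic comparison and a
bound on the noise W.

Deterministic part: for feasible X let δ_k be the mass missing from the k-th diagonal block. The
total-mass constraint forces the mass of X outside the blocks to equal ∑ δ_k, so the signal favours
X₀ over X by at least ∑ (Ψ_kk - q⁺) δ_k (`sum_block_weights`). The noise is measured in the same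
currency. Let T = X₀/m be the projection onto block-constant vectors. Expanding W around T leaves
three terms controlled by block row sums of W, and the term -tr(W (1-T)X(1-T)), controlled by a
Loewner bound W ≤ diag(N_k + R), where N_k bounds the noise of block k and R the noise outside the
blocks. Altogether the noise costs at most ∑ 4(N_k + R)/m · δ_k (`neg_le_trace_noise_mul_sub`). If
4(N_k + R) < (Ψ_kk - q⁺)m for every k, each δ_k carries a positive coefficient, so X₀ is the unique
maximizer.

Probabilistic part: with L = log n, both N_k and R have the form 60√((s+L)L), where s bounds a row
variance. Row sums obey this by a Chernoff bound. The spectral bound uses the trace method at order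
k = ⌈L⌉: in the expansion of tr W^{2k} only walks repeating each edge survive, which gives 𝔼 tr
W^{2k} ≤ |V|(8k(2k+s))^k, and Markov's inequality finishes. After division by L the gap condition
follows from the hypothesis on p̃ and q̃ (`sqrt_gap`), and a union bound gives failure probability
at most 4/n. -/

noncomputable section

set_option linter.unusedSectionVars false

namespace BlockModel

/-! ### Trace moments of a sparse noise matrix by counting walks. -/

section Moments

variable {Ω ι V : Type*} [MeasurableSpace Ω] {P : Measure Ω} [IsProbabilityMeasure P]
  [Fintype ι] [DecidableEq ι] [Fintype V] [DecidableEq V]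

/-- Independent centred random variables, bounded by `1`, with variances at most `σ`. -/
structure IsCenteredNoise (P : Measure Ω) (ξ : ι → Ω → ℝ) (σ : ι → ℝ) : Prop where
  measurable : ∀ e, Measurable (ξ e)
  indep : iIndepFun ξ P
  abs_le_one : ∀ e ω, |ξ e ω| ≤ 1
  integral_eq_zero : ∀ e, ∫ ω, ξ e ω ∂P = 0
  integral_sq_le : ∀ e, ∫ ω, ξ e ω ^ 2 ∂P ≤ σ e

theorem integrable_of_abs_le {f : Ω → ℝ} (hf : Measurable f) (c : ℝ) (h : ∀ ω, |f ω| ≤ c) :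
    Integrable f P :=
  Integrable.of_bound hf.aestronglyMeasurable c (Filter.Eventually.of_forall h)

theorem IsCenteredNoise.variance_nonneg {ξ : ι → Ω → ℝ} {σ : ι → ℝ} (h : IsCenteredNoise P ξ σ)
    (e : ι) : 0 ≤ σ e :=
  (integral_nonneg fun ω => sq_nonneg (ξ e ω)).trans (h.integral_sq_le e)

theorem IsCenteredNoise.abs_integral_pow_le {ξ : ι → Ω → ℝ} {σ : ι → ℝ}
    (h : IsCenteredNoise P ξ σ) (e : ι) {c : ℕ} (hc : 2 ≤ c) :
    |∫ ω, ξ e ω ^ c ∂P| ≤ σ e := by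
  refine (abs_integral_le_integral_abs).trans (le_trans (integral_mono ?_ ?_ ?_)
    (h.integral_sq_le e))
  · refine integrable_of_abs_le ((h.measurable e).pow_const c).abs 1 fun ω => ?_
    rw [abs_abs, abs_pow]
    exact pow_le_one₀ (abs_nonneg _) (h.abs_le_one e ω)
  · refine integrable_of_abs_le ((h.measurable e).pow_const 2) 1 fun ω => ?_
    rw [abs_pow]
    exact pow_le_one₀ (abs_nonneg _) (h.abs_le_one e ω)
  · intro ω
    simp only
    rw [abs_pow, ← sq_abs (ξ e ω)]
    exact pow_le_pow_of_le_one (abs_nonneg _) (h.abs_le_one e ω) hc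

/-- By independence an edge occurring exactly once makes the expectation vanish. Otherwise every
edge occurs at least twice, so there are at most `k` distinct ones and each contributes at most its
variance. The parameter `lam ≥ 1` trades a factor per distinct edge for the uniform factor `lam ^
k`, which lets the walk be summed step by step. -/
theorem IsCenteredNoise.abs_integral_list_prod_le {ξ : ι → Ω → ℝ} {σ : ι → ℝ}
    (h : IsCenteredNoise P ξ σ) {lam : ℝ} (hlam : 1 ≤ lam) {k : ℕ} {l : List ι}
    (hl : l.length = 2 * k) :
    |∫ ω, (l.map fun e => ξ e ω).prod ∂P| ≤ lam ^ k * ∏ e ∈ l.toFinset, σ e / lam := by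
  have hlam0 : 0 < lam := by linarith
  have h1 : ∫ ω, (l.map fun e => ξ e ω).prod ∂P = ∏ e, ∫ ω, ξ e ω ^ l.count e ∂P := by
    have hi : iIndepFun (fun e => (fun x : ℝ => x ^ l.count e) ∘ ξ e) P :=
      h.indep.comp (fun e x => x ^ l.count e) (fun e => by fun_prop)
    have h2 := hi.integral_fun_prod_eq_prod_integral
      (fun e => (by
        have := (h.measurable e).pow_const (l.count e)
        exact this.aestronglyMeasurable))
    simp only [Function.comp] at h2
    rw [← h2]
    congr 1
    ext ω
    rw [Finset.prod_list_map_count]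
    refine Finset.prod_subset (Finset.subset_univ _) fun e _ he => ?_
    rw [List.count_eq_zero_of_not_mem (by simpa using he), pow_zero]
  have hrhs : 0 ≤ lam ^ k * ∏ e ∈ l.toFinset, σ e / lam :=
    mul_nonneg (by positivity)
      (Finset.prod_nonneg fun e _ => div_nonneg (h.variance_nonneg e) hlam0.le)
  rw [h1]
  by_cases hone : ∃ e, l.count e = 1
  · obtain ⟨e, he⟩ := hone
    rw [Finset.prod_eq_zero (Finset.mem_univ e), abs_zero]
    · exact hrhs
    · rw [he]; simpa using h.integral_eq_zero e
  push Not at hone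
  have hcount : ∀ e ∈ l.toFinset, 2 ≤ l.count e := by
    intro e he
    have := List.count_pos_iff.2 (List.mem_toFinset.1 he)
    have := hone e
    omega
  have hcard : l.toFinset.card ≤ k := by
    have h3 : ∑ e ∈ l.toFinset, l.count e = l.length := List.sum_toFinset_count_eq_length l
    have h4 := Finset.sum_le_sum hcount
    rw [Finset.sum_const, smul_eq_mul] at h4
    omega
  have h5 : ∏ e, ∫ ω, ξ e ω ^ l.count e ∂P = ∏ e ∈ l.toFinset, ∫ ω, ξ e ω ^ l.count e ∂P := by
    symm
    refine Finset.prod_subset (Finset.subset_univ _) fun e _ he => ?_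
    rw [List.count_eq_zero_of_not_mem (by simpa using he)]
    simp
  rw [h5, Finset.abs_prod]
  calc ∏ e ∈ l.toFinset, |∫ ω, ξ e ω ^ l.count e ∂P|
      ≤ ∏ e ∈ l.toFinset, lam * (σ e / lam) := by
        refine Finset.prod_le_prod (fun _ _ => abs_nonneg _) fun e he => ?_
        rw [mul_div_cancel₀ _ hlam0.ne']
        exact h.abs_integral_pow_le e (hcount e he)
    _ = lam ^ l.toFinset.card * ∏ e ∈ l.toFinset, σ e / lam := by
        rw [Finset.prod_mul_distrib, Finset.prod_const]
    _ ≤ _ := by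
        refine mul_le_mul_of_nonneg_right (pow_le_pow_right₀ hlam hcard) ?_
        exact Finset.prod_nonneg fun e _ => div_nonneg (h.variance_nonneg e) hlam0.le

/-- The matrix with entry `ξ (ε u v)` where `c u v` holds and `0` elsewhere. -/
def noiseMatrix (ξ : ι → Ω → ℝ) (c : V → V → Prop) [∀ u v, Decidable (c u v)] (ε : V → V → ι)
    (ω : Ω) : Matrix V V ℝ :=
  Matrix.of fun u v => if c u v then ξ (ε u v) ω else 0

variable {ξ : ι → Ω → ℝ} {σ : ι → ℝ} {c : V → V → Prop} [∀ u v, Decidable (c u v)]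
  {ε : V → V → ι}

theorem IsCenteredNoise.measurable_noiseMatrix (h : IsCenteredNoise P ξ σ) (u v : V) :
    Measurable fun ω => noiseMatrix ξ c ε ω u v := by
  unfold noiseMatrix
  by_cases hc : c u v
  · simpa [hc] using h.measurable (ε u v)
  · simp [hc]

theorem IsCenteredNoise.measurable_noiseMatrix_pow (h : IsCenteredNoise P ξ σ) (L : ℕ) (u v : V) :
    Measurable fun ω => (noiseMatrix ξ c ε ω ^ L) u v := by
  induction L generalizing u v with
  | zero => simp
  | succ L ih =>
    simp only [pow_succ', Matrix.mul_apply]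
    exact Finset.measurable_sum _ fun w _ => (h.measurable_noiseMatrix u w).mul (ih w v)

theorem IsCenteredNoise.abs_noiseMatrix_pow_le (h : IsCenteredNoise P ξ σ) (L : ℕ) (u v : V)
    (ω : Ω) : |(noiseMatrix ξ c ε ω ^ L) u v| ≤ (Fintype.card V : ℝ) ^ L := by
  induction L generalizing u v with
  | zero =>
    rw [pow_zero, pow_zero, Matrix.one_apply]
    split_ifs <;> simp
  | succ L ih =>
    simp only [pow_succ', Matrix.mul_apply]
    refine (Finset.abs_sum_le_sum_abs _ _).trans ?_
    calc _ ≤ ∑ _w : V, (Fintype.card V : ℝ) ^ L := by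
          refine Finset.sum_le_sum fun w _ => ?_
          rw [abs_mul]
          refine (mul_le_of_le_one_left (abs_nonneg _) ?_).trans (ih w v)
          unfold noiseMatrix
          simp only [Matrix.of_apply]
          split_ifs
          · exact h.abs_le_one _ _
          · simp
      _ = _ := by simp

theorem IsCenteredNoise.integrable_list_prod_mul_pow (h : IsCenteredNoise P ξ σ) (l : List ι)
    (L : ℕ) (u v : V) :
    Integrable (fun ω => (l.map fun e => ξ e ω).prod * (noiseMatrix ξ c ε ω ^ L) u v) P := by
  have hm : Measurable fun ω => (l.map fun e => ξ e ω).prod := by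
    induction l with
    | nil => simp
    | cons e l ih =>
      simp only [List.map_cons, List.prod_cons]
      exact (h.measurable e).mul ih
  have hb : ∀ ω, |(l.map fun e => ξ e ω).prod| ≤ 1 := by
    intro ω
    clear hm
    induction l with
    | nil => simp
    | cons e l ih =>
      rw [List.map_cons, List.prod_cons, abs_mul]
      exact mul_le_one₀ (h.abs_le_one e ω) (abs_nonneg _) ih
  refine integrable_of_abs_le (hm.mul (h.measurable_noiseMatrix_pow L u v))
    ((Fintype.card V : ℝ) ^ L) fun ω => ?_
  rw [abs_mul]
  exact (mul_le_of_le_one_left (abs_nonneg _) (hb ω)).trans (h.abs_noiseMatrix_pow_le L u v ω)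

/-- One step of the walk: a new edge costs its variance over `lam`, summing to at most `s / lam`; an
old edge costs nothing, and since the edge determines the next vertex there are at most `l.length`
such steps. -/
theorem IsCenteredNoise.sum_prod_toFinset_cons_le (h : IsCenteredNoise P ξ σ)
    (hinj : ∀ u v w, c u v → c u w → ε u v = ε u w → v = w)
    {s lam : ℝ} (hs : ∀ u, (∑ v, if c u v then σ (ε u v) else 0) ≤ s)
    (hlam : 0 < lam) (u : V) (l : List ι) :
    (∑ w, if c u w then ∏ e ∈ (ε u w :: l).toFinset, σ e / lam else 0) ≤
      (∏ e ∈ l.toFinset, σ e / lam) * (s / lam + l.length) := by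
  have h0 : 0 ≤ ∏ e ∈ l.toFinset, σ e / lam :=
    Finset.prod_nonneg fun e _ => div_nonneg (h.variance_nonneg e) hlam.le
  have hold : (∑ w, if c u w ∧ ε u w ∈ l then (1 : ℝ) else 0) ≤ l.length := by
    rw [Finset.sum_boole]
    have h1 : (Finset.univ.filter fun w => c u w ∧ ε u w ∈ l).card ≤ l.toFinset.card := by
      refine Finset.card_le_card_of_injOn (ε u) ?_ ?_
      · intro w hw
        simp only [Finset.coe_filter, Finset.mem_univ, true_and, Set.mem_ofPred_eq] at hw
        simpa using hw.2
      · intro w hw w' hw' he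
        simp only [Finset.coe_filter, Finset.mem_univ, true_and, Set.mem_ofPred_eq] at hw hw'
        exact hinj u w w' hw.1 hw'.1 he
    exact_mod_cast h1.trans (List.toFinset_card_le l)
  calc _ ≤ ∑ w, (∏ e ∈ l.toFinset, σ e / lam) *
        ((if c u w then σ (ε u w) else 0) / lam + if c u w ∧ ε u w ∈ l then (1 : ℝ) else 0) := by
        refine Finset.sum_le_sum fun w _ => ?_
        by_cases hc : c u w
        · by_cases he : ε u w ∈ l
          · have : (ε u w :: l).toFinset = l.toFinset := by
              rw [List.toFinset_cons, Finset.insert_eq_of_mem (by simpa using he)]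
            simp only [hc, he, this, if_true, and_self]
            have := div_nonneg (h.variance_nonneg (ε u w)) hlam.le
            nlinarith
          · rw [List.toFinset_cons, Finset.prod_insert (by simpa using he)]
            simp only [hc, he, if_true, and_false, if_false, add_zero]
            rw [mul_comm]
        · simp [hc]
    _ = (∏ e ∈ l.toFinset, σ e / lam) * ((∑ w, if c u w then σ (ε u w) else 0) / lam +
          ∑ w, if c u w ∧ ε u w ∈ l then (1 : ℝ) else 0) := by
        rw [← Finset.mul_sum, Finset.sum_add_distrib, Finset.sum_div]
    _ ≤ _ := by
        refine mul_le_mul_of_nonneg_left (add_le_add ?_ hold) h0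
        exact div_le_div_of_nonneg_right (hs u) hlam.le

/-- Induction on the remaining length `L`, with `l` the edges already walked. Endpoints are left
free and absolute values are taken inside the sum so that the induction closes. -/
theorem IsCenteredNoise.sum_abs_integral_le (h : IsCenteredNoise P ξ σ)
    (hinj : ∀ u v w, c u v → c u w → ε u v = ε u w → v = w)
    {s lam : ℝ} (hs : ∀ u, (∑ v, if c u v then σ (ε u v) else 0) ≤ s) (hs0 : 0 ≤ s)
    (hlam : 1 ≤ lam) {k : ℕ} (L : ℕ) (u : V) (l : List ι) (hl : l.length + L = 2 * k) :
    ∑ v, |∫ ω, (l.map fun e => ξ e ω).prod * (noiseMatrix ξ c ε ω ^ L) u v ∂P| ≤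
      lam ^ k * (∏ e ∈ l.toFinset, σ e / lam) * (s / lam + 2 * k) ^ L := by
  have hlam0 : 0 < lam := by linarith
  have hK : 0 ≤ s / lam + 2 * (k : ℝ) := by positivity
  induction L generalizing u l with
  | zero =>
    rw [Finset.sum_eq_single u]
    · simpa using h.abs_integral_list_prod_le hlam (by omega)
    · intro v _ hv
      simp [Matrix.one_apply_ne' hv]
    · simp
  | succ L ih =>
    have hstep : ∀ v, |∫ ω, (l.map fun e => ξ e ω).prod * (noiseMatrix ξ c ε ω ^ (L + 1)) u v ∂P| ≤
        ∑ w, if c u w then |∫ ω, ((ε u w :: l).map fun e => ξ e ω).prod *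
          (noiseMatrix ξ c ε ω ^ L) w v ∂P| else 0 := by
      intro v
      have h1 : ∀ ω, (l.map fun e => ξ e ω).prod * (noiseMatrix ξ c ε ω ^ (L + 1)) u v =
          ∑ w, if c u w then ((ε u w :: l).map fun e => ξ e ω).prod *
            (noiseMatrix ξ c ε ω ^ L) w v else 0 := by
        intro ω
        rw [pow_succ', Matrix.mul_apply, Finset.mul_sum]
        refine Finset.sum_congr rfl fun w _ => ?_
        conv_lhs => enter [2, 1]; rw [noiseMatrix, Matrix.of_apply]
        split_ifs
        · rw [List.map_cons, List.prod_cons]; ring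
        · ring
      simp_rw [h1]
      rw [integral_finsetSum]
      · refine (Finset.abs_sum_le_sum_abs _ _).trans (Finset.sum_le_sum fun w _ => ?_)
        split_ifs
        · exact le_rfl
        · simp
      · intro w _
        split_ifs
        · exact h.integrable_list_prod_mul_pow _ L w v
        · exact integrable_zero _ _ _
    calc _ ≤ ∑ v, ∑ w, if c u w then |∫ ω, ((ε u w :: l).map fun e => ξ e ω).prod *
          (noiseMatrix ξ c ε ω ^ L) w v ∂P| else 0 := Finset.sum_le_sum fun v _ => hstep v
      _ = ∑ w, if c u w then ∑ v, |∫ ω, ((ε u w :: l).map fun e => ξ e ω).prod *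
          (noiseMatrix ξ c ε ω ^ L) w v ∂P| else 0 := by
          rw [Finset.sum_comm]
          refine Finset.sum_congr rfl fun w _ => ?_
          split_ifs <;> simp
      _ ≤ ∑ w, lam ^ k * (s / lam + 2 * k) ^ L *
            if c u w then ∏ e ∈ (ε u w :: l).toFinset, σ e / lam else 0 := by
          refine Finset.sum_le_sum fun w _ => ?_
          split_ifs
          · refine (ih w (ε u w :: l) (by rw [List.length_cons]; omega)).trans (le_of_eq ?_)
            ring
          · simp
      _ ≤ lam ^ k * (s / lam + 2 * k) ^ L *
            ((∏ e ∈ l.toFinset, σ e / lam) * (s / lam + 2 * k)) := by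
          rw [← Finset.mul_sum]
          refine mul_le_mul_of_nonneg_left ?_ (by positivity)
          refine (h.sum_prod_toFinset_cons_le hinj hs hlam0 u l).trans ?_
          refine mul_le_mul_of_nonneg_left ?_
            (Finset.prod_nonneg fun e _ => div_nonneg (h.variance_nonneg e) hlam0.le)
          have : (l.length : ℝ) ≤ 2 * k := by exact_mod_cast (by omega : l.length ≤ 2 * k)
          linarith
      _ = _ := by ring

/-- Moment bound for the spectrum of a sparse noise matrix. -/
theorem IsCenteredNoise.integral_trace_pow_le (h : IsCenteredNoise P ξ σ)
    (hinj : ∀ u v w, c u v → c u w → ε u v = ε u w → v = w)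
    {s : ℝ} (hs : ∀ u, (∑ v, if c u v then σ (ε u v) else 0) ≤ s) (hs0 : 0 ≤ s)
    {k : ℕ} (hk : 1 ≤ k) :
    ∫ ω, (noiseMatrix ξ c ε ω ^ (2 * k)).trace ∂P ≤
      Fintype.card V * (8 * k * (2 * k + s)) ^ k := by
  have hk0 : (0 : ℝ) < k := by exact_mod_cast hk
  -- This choice gives `s / lam ≤ 2 * k`, so new and old edges weigh about the same, and `lam * (4 *
  -- k) ^ 2 = 8 * k * (2 * k + s)`.
  set lam : ℝ := 1 + s / (2 * k) with hlam
  have hlam1 : 1 ≤ lam := by rw [hlam]; have : 0 ≤ s / (2 * k) := by positivity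
                             linarith
  have hlam0 : 0 < lam := by linarith
  have hsl : s / lam ≤ 2 * k := by
    rw [div_le_iff₀ hlam0, hlam]
    have : 2 * (k : ℝ) * (1 + s / (2 * k)) = 2 * k + s := by field_simp
    linarith
  have hint : ∀ u, Integrable (fun ω => (noiseMatrix ξ c ε ω ^ (2 * k)) u u) P := fun u => by
    simpa using h.integrable_list_prod_mul_pow (c := c) (ε := ε) [] (2 * k) u u
  have hentry : ∀ u, ∫ ω, (noiseMatrix ξ c ε ω ^ (2 * k)) u u ∂P ≤ (8 * k * (2 * k + s)) ^ k := by
    intro u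
    have h1 := h.sum_abs_integral_le (k := k) hinj hs hs0 hlam1 (2 * k) u [] (by simp)
    simp only [List.map_nil, List.prod_nil, one_mul, List.toFinset_nil, Finset.prod_empty,
      mul_one] at h1
    calc _ ≤ |∫ ω, (noiseMatrix ξ c ε ω ^ (2 * k)) u u ∂P| := le_abs_self _
      _ ≤ ∑ v, |∫ ω, (noiseMatrix ξ c ε ω ^ (2 * k)) u v ∂P| :=
          Finset.single_le_sum (f := fun v => |∫ ω, (noiseMatrix ξ c ε ω ^ (2 * k)) u v ∂P|)
            (fun _ _ => abs_nonneg _) (Finset.mem_univ u)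
      _ ≤ lam ^ k * (s / lam + 2 * k) ^ (2 * k) := h1
      _ ≤ lam ^ k * (4 * k) ^ (2 * k) := by
          refine mul_le_mul_of_nonneg_left (pow_le_pow_left₀ (by positivity) (by linarith) _)
            (by positivity)
      _ = _ := by
          rw [pow_mul, ← mul_pow, hlam]
          congr 1
          field_simp
          ring
  calc _ = ∑ u, ∫ ω, (noiseMatrix ξ c ε ω ^ (2 * k)) u u ∂P := by
        simp only [Matrix.trace, Matrix.diag_apply]
        exact integral_finsetSum _ fun u _ => hint u
    _ ≤ ∑ _u : V, (8 * k * (2 * k + s)) ^ k := Finset.sum_le_sum fun u _ => hentry u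
    _ = _ := by simp

end Moments

/-! ### From trace powers to the Loewner order. -/

section Spectrum

variable {V : Type*} [Fintype V] [DecidableEq V]

theorem dotProduct_mulVec_self_le_sum_sq (M : Matrix V V ℝ) (x : V → ℝ) :
    M.mulVec x ⬝ᵥ M.mulVec x ≤ (∑ i, ∑ j, M i j ^ 2) * (x ⬝ᵥ x) := by
  simp only [dotProduct, Matrix.mulVec, Finset.sum_mul]
  refine Finset.sum_le_sum fun i _ => ?_
  have := Finset.sum_mul_sq_le_sq_mul_sq Finset.univ (fun j => M i j) x
  simp only [← Finset.sum_mul] at this ⊢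
  simp only [← sq]
  exact this

/-- A symmetric matrix with `tr W^{2k} ≤ N^{2k}` satisfies `W ≤ N` in the Loewner order. -/
theorem posSemidef_smul_one_sub_of_trace_pow_le {W : Matrix V V ℝ} (hW : W.IsSymm) {N : ℝ}
    (hN : 0 ≤ N) {k : ℕ} (hk : 1 ≤ k) (h : (W ^ (2 * k)).trace ≤ N ^ (2 * k)) :
    (N • (1 : Matrix V V ℝ) - W).PosSemidef := by
  have hherm : (N • (1 : Matrix V V ℝ) - W).IsHermitian := by
    simp only [Matrix.IsHermitian, Matrix.conjTranspose_eq_transpose_of_trivial,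
      Matrix.transpose_sub, Matrix.transpose_smul, Matrix.transpose_one, hW.eq]
  rw [hherm.posSemidef_iff_eigenvalues_nonneg]
  intro i
  -- An eigenvector of `N - W` with eigenvalue `μ < 0` has `W`-eigenvalue `N - μ > N`; testing `W ^
  -- k` on it against its Frobenius norm forces the trace above `N ^ (2 * k)`.
  by_contra! hneg
  simp only [Pi.zero_apply] at hneg
  set μ := hherm.eigenvalues i
  set x : V → ℝ := ⇑(hherm.eigenvectorBasis i)
  have hx : (N • (1 : Matrix V V ℝ) - W).mulVec x = μ • x := hherm.mulVec_eigenvectorBasis i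
  have hWx : W.mulVec x = (N - μ) • x := by
    rw [Matrix.sub_mulVec, Matrix.smul_mulVec, Matrix.one_mulVec] at hx
    rw [sub_smul, ← hx]; abel
  have hpow : ∀ j : ℕ, (W ^ j).mulVec x = (N - μ) ^ j • x := by
    intro j
    induction j with
    | zero => simp
    | succ j ih =>
      rw [pow_succ', ← Matrix.mulVec_mulVec, ih, Matrix.mulVec_smul, hWx, smul_smul, pow_succ]
  have hxx : 0 < x ⬝ᵥ x := by
    have hx0 : x ≠ 0 := by
      intro h0
      have := hherm.eigenvectorBasis.orthonormal.1 i
      have h1 : hherm.eigenvectorBasis i = 0 := by ext j; exact congrFun h0 j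
      rw [h1] at this
      simp at this
    have : 0 ≤ x ⬝ᵥ x := Finset.sum_nonneg fun j _ => mul_self_nonneg _
    refine lt_of_le_of_ne this fun h0 => hx0 (dotProduct_self_eq_zero.1 h0.symm)
  have h1 := dotProduct_mulVec_self_le_sum_sq (W ^ k) x
  have h2 : ∑ i, ∑ j, (W ^ k) i j ^ 2 = (W ^ (2 * k)).trace := by
    have hs : (W ^ k).IsSymm := by rw [Matrix.IsSymm, Matrix.transpose_pow, hW.eq]
    rw [two_mul, pow_add, Matrix.trace]
    refine Finset.sum_congr rfl fun i _ => ?_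
    rw [Matrix.diag_apply, Matrix.mul_apply]
    refine Finset.sum_congr rfl fun j _ => ?_
    rw [← hs.apply i j, sq, hs.apply i j]
  rw [h2, hpow, smul_dotProduct, dotProduct_smul, smul_eq_mul, smul_eq_mul, ← mul_assoc,
    ← pow_add, ← two_mul] at h1
  have h3 := (le_of_mul_le_mul_right h1 hxx).trans h
  have h4 : N ^ (2 * k) < (N - μ) ^ (2 * k) := pow_lt_pow_left₀ (by linarith) hN (by omega)
  linarith

end Spectrum

/-! ### Tail bounds for sums and for the spectrum of the noise. -/

section Concentration

variable {Ω ι V : Type*} [MeasurableSpace Ω] {P : Measure Ω} [IsProbabilityMeasure P]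
  [Fintype ι] [DecidableEq ι] [Fintype V] [DecidableEq V]
  {ξ : ι → Ω → ℝ} {σ : ι → ℝ}

/-- The deviation scale `√((s + L) L)` of a sum of total variance `s` at confidence `e^{-L}`,
with the constant that makes all the tail bounds below summable. -/
def noiseLevel (s L : ℝ) : ℝ :=
  60 * Real.sqrt ((s + L) * L)

theorem noiseLevel_nonneg (s L : ℝ) : 0 ≤ noiseLevel s L :=
  mul_nonneg (by norm_num) (Real.sqrt_nonneg _)

theorem IsCenteredNoise.neg (h : IsCenteredNoise P ξ σ) : IsCenteredNoise P (fun e ω => -ξ e ω) σ where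
  measurable e := (h.measurable e).neg
  indep := h.indep.comp (fun _ x => -x) (fun _ => measurable_neg)
  abs_le_one e ω := by rw [abs_neg]; exact h.abs_le_one e ω
  integral_eq_zero e := by rw [integral_neg, h.integral_eq_zero, neg_zero]
  integral_sq_le e := by simpa using h.integral_sq_le e

theorem IsCenteredNoise.mgf_le (h : IsCenteredNoise P ξ σ) {t : ℝ} (ht0 : 0 ≤ t) (ht1 : t ≤ 1)
    (e : ι) : mgf (ξ e) P t ≤ Real.exp (t ^ 2 * σ e) := by
  have hb : ∀ ω, |t * ξ e ω| ≤ 1 := fun ω => by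
    rw [abs_mul, abs_of_nonneg ht0]
    exact mul_le_one₀ ht1 (abs_nonneg _) (h.abs_le_one e ω)
  have hi1 : Integrable (ξ e) P := integrable_of_abs_le (h.measurable e) 1 (h.abs_le_one e)
  have hi2 : Integrable (fun ω => ξ e ω ^ 2) P :=
    integrable_of_abs_le ((h.measurable e).pow_const 2) 1 fun ω => by
      rw [abs_pow]; exact pow_le_one₀ (abs_nonneg _) (h.abs_le_one e ω)
  have hi3 : Integrable (fun ω => Real.exp (t * ξ e ω)) P :=
    integrable_of_abs_le ((h.measurable e).const_mul t).exp (Real.exp 1) fun ω => by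
      rw [abs_of_pos (Real.exp_pos _), Real.exp_le_exp]
      exact (le_abs_self _).trans (hb ω)
  calc mgf (ξ e) P t = ∫ ω, Real.exp (t * ξ e ω) ∂P := rfl
    _ ≤ ∫ ω, (1 + t * ξ e ω + t ^ 2 * ξ e ω ^ 2) ∂P := by
        refine integral_mono hi3
          (((integrable_const _).add (hi1.const_mul t)).add (hi2.const_mul (t ^ 2))) fun ω => ?_
        have := (abs_le.1 (Real.abs_exp_sub_one_sub_id_le (hb ω))).2
        simp only
        nlinarith
    _ = 1 + t * 0 + t ^ 2 * ∫ ω, ξ e ω ^ 2 ∂P := by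
        have h1 : Integrable (fun ω => 1 + t * ξ e ω) P :=
          (integrable_const _).add (hi1.const_mul t)
        rw [integral_add h1 (hi2.const_mul (t ^ 2)),
          integral_add (integrable_const _) (hi1.const_mul t), integral_const_mul,
          integral_const_mul, h.integral_eq_zero]
        simp
    _ ≤ t ^ 2 * σ e + 1 := by
        have := mul_le_mul_of_nonneg_left (h.integral_sq_le e) (sq_nonneg t)
        linarith
    _ ≤ _ := Real.add_one_le_exp _

theorem IsCenteredNoise.measureReal_sum_ge_le (h : IsCenteredNoise P ξ σ) {S : Finset ι}
    {s L : ℝ} (hL : 0 < L) (hs : ∑ e ∈ S, σ e ≤ s) :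
    P.real {ω | noiseLevel s L ≤ ∑ e ∈ S, ξ e ω} ≤ Real.exp (-(3 * L)) := by
  have hs0 : 0 ≤ s := (Finset.sum_nonneg fun e _ => h.variance_nonneg e).trans hs
  have hsL : 0 < s + L := by linarith
  -- The Chernoff parameter: `t ≤ 1`, `t ^ 2 * s ≤ L` and `t * noiseLevel s L = 60 * L`, so the
  -- exponent is at most `L - 60 * L`.
  set t := Real.sqrt (L / (s + L)) with ht
  have ht0 : 0 ≤ t := Real.sqrt_nonneg _
  have ht1 : t ≤ 1 := Real.sqrt_le_one.2 ((div_le_one hsL).2 (by linarith))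
  have ht2 : t ^ 2 = L / (s + L) := Real.sq_sqrt (by positivity)
  have htL : t * noiseLevel s L = 60 * L := by
    rw [noiseLevel, ht, mul_left_comm, ← Real.sqrt_mul (by positivity)]
    rw [show L / (s + L) * ((s + L) * L) = L ^ 2 by field_simp, Real.sqrt_sq hL.le]
  have hts : t ^ 2 * s ≤ L := by
    rw [ht2, div_mul_eq_mul_div, div_le_iff₀ hsL]; nlinarith
  have hmgf : mgf (∑ e ∈ S, ξ e) P t ≤ Real.exp L := by
    rw [h.indep.mgf_sum h.measurable]
    calc _ ≤ ∏ e ∈ S, Real.exp (t ^ 2 * σ e) :=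
          Finset.prod_le_prod (fun _ _ => mgf_nonneg) fun e _ => h.mgf_le ht0 ht1 e
      _ = Real.exp (t ^ 2 * ∑ e ∈ S, σ e) := by rw [← Real.exp_sum, Finset.mul_sum]
      _ ≤ _ := Real.exp_le_exp.2
          ((mul_le_mul_of_nonneg_left hs (sq_nonneg t)).trans hts)
  have hint : Integrable (fun ω => Real.exp (t * (∑ e ∈ S, ξ e) ω)) P := by
    refine integrable_of_abs_le ?_ (Real.exp (t * S.card)) fun ω => ?_
    · simp only [Finset.sum_apply]
      exact ((Finset.measurable_sum S fun e _ => h.measurable e).const_mul t).exp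
    · rw [abs_of_pos (Real.exp_pos _), Real.exp_le_exp, Finset.sum_apply]
      refine mul_le_mul_of_nonneg_left ?_ ht0
      calc _ ≤ ∑ _e ∈ S, (1 : ℝ) :=
            Finset.sum_le_sum fun e _ => (le_abs_self _).trans (h.abs_le_one e ω)
        _ = _ := by simp
  have h1 := measure_ge_le_exp_mul_mgf (X := ∑ e ∈ S, ξ e) (noiseLevel s L) ht0 hint
  simp only [Finset.sum_apply] at h1
  refine h1.trans ((mul_le_mul_of_nonneg_left hmgf (Real.exp_pos _).le).trans ?_)
  rw [← Real.exp_add, Real.exp_le_exp, neg_mul, htL]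
  linarith

theorem IsCenteredNoise.measureReal_abs_sum_gt_le (h : IsCenteredNoise P ξ σ) {S : Finset ι}
    {s L : ℝ} (hL : 0 < L) (hs : ∑ e ∈ S, σ e ≤ s) :
    P.real {ω | ¬ |∑ e ∈ S, ξ e ω| ≤ noiseLevel s L} ≤ 2 * Real.exp (-(3 * L)) := by
  have h1 := h.measureReal_sum_ge_le hL hs
  have h2 := h.neg.measureReal_sum_ge_le hL hs
  have hsub : {ω | ¬ |∑ e ∈ S, ξ e ω| ≤ noiseLevel s L} ⊆
      {ω | noiseLevel s L ≤ ∑ e ∈ S, ξ e ω} ∪ {ω | noiseLevel s L ≤ ∑ e ∈ S, -ξ e ω} := by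
    intro ω hω
    simp only [Set.mem_ofPred_eq, not_le, lt_abs, Set.mem_union, Finset.sum_neg_distrib] at hω ⊢
    exact hω.imp le_of_lt le_of_lt
  calc _ ≤ _ := measureReal_mono hsub
    _ ≤ _ := measureReal_union_le _ _
    _ ≤ _ := by linarith

/-- Spectral bound for a sparse noise matrix whose row variances are at most `s`. -/
theorem IsCenteredNoise.measureReal_not_posSemidef_le (h : IsCenteredNoise P ξ σ)
    {c : V → V → Prop} [∀ u v, Decidable (c u v)] {ε : V → V → ι}
    (hinj : ∀ u v w, c u v → c u w → ε u v = ε u w → v = w)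
    (hc : ∀ u v, c u v ↔ c v u) (hε : ∀ u v, ε u v = ε v u)
    {s L : ℝ} (hs : ∀ u, (∑ v, if c u v then σ (ε u v) else 0) ≤ s) (hs0 : 0 ≤ s)
    (hL : 2 / 3 ≤ L) (hV : (Fintype.card V : ℝ) ≤ Real.exp L) :
    P.real {ω | ¬ (noiseLevel s L • (1 : Matrix V V ℝ) - noiseMatrix ξ c ε ω).PosSemidef} ≤
      Real.exp (-(2 * L)) := by
  set N := noiseLevel s L with hN
  -- A moment of order about `log |V|` absorbs the dimension factor; `L ≥ 2 / 3` gives `L + 1 ≤ 5 /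
  -- 2 * L`, so rounding up costs a constant.
  set k := ⌈L⌉₊ with hk
  have hkL : L ≤ k := Nat.le_ceil L
  have hkL' : (k : ℝ) ≤ 5 / 2 * L := (Nat.ceil_lt_add_one (by linarith)).le.trans (by linarith)
  have hk1 : 1 ≤ k := Nat.one_le_ceil_iff.2 (by linarith)
  have hsymm : ∀ ω, (noiseMatrix ξ c ε ω).IsSymm := fun ω => by
    refine Matrix.IsSymm.ext fun u v => ?_
    simp only [noiseMatrix, Matrix.of_apply, hc v u, hε v u]
  have hN2 : N ^ 2 = 3600 * ((s + L) * L) := by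
    rw [hN, noiseLevel, mul_pow, Real.sq_sqrt (by nlinarith)]; norm_num
  have hNpos : 0 < N ^ 2 := by rw [hN2]; nlinarith
  have hexp3 : Real.exp 3 ≤ 36 := by
    have := Real.exp_one_lt_d9
    have h3 : Real.exp 3 = Real.exp 1 ^ 3 := by rw [← Real.exp_nat_mul]; norm_num
    rw [h3]
    calc Real.exp 1 ^ 3 ≤ (2.8 : ℝ) ^ 3 :=
          pow_le_pow_left₀ (Real.exp_pos _).le (by linarith) _
      _ ≤ 36 := by norm_num
  -- Origin of the constant 60: `60 ^ 2 = 100 * 36`, with 100 from `k ≤ 5 / 2 * L` and `36 ≥ exp 3`.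
  -- Markov then yields `exp (L - 3 * k) ≤ exp (-(2 * L))`.
  have hbase : 8 * k * (2 * k + s) ≤ Real.exp (-3) * N ^ 2 := by
    have h1 : 8 * k * (2 * k + s) ≤ 100 * ((s + L) * L) := by
      calc 8 * (k : ℝ) * (2 * k + s) ≤ 8 * (5 / 2 * L) * (2 * (5 / 2 * L) + s) := by gcongr
        _ ≤ _ := by nlinarith
    rw [Real.exp_neg, inv_mul_eq_div, le_div_iff₀ (Real.exp_pos _), hN2]
    have : 0 ≤ (s + L) * L := by nlinarith
    calc _ ≤ 100 * ((s + L) * L) * 36 := by gcongr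
      _ = _ := by ring
  have hsub : {ω | ¬ (N • (1 : Matrix V V ℝ) - noiseMatrix ξ c ε ω).PosSemidef} ⊆
      {ω | N ^ (2 * k) ≤ (noiseMatrix ξ c ε ω ^ (2 * k)).trace} := by
    intro ω hω
    by_contra hlt
    exact hω (posSemidef_smul_one_sub_of_trace_pow_le (hsymm ω) (noiseLevel_nonneg _ _) hk1
      (le_of_lt (not_le.1 hlt)))
  have hnn : ∀ ω, 0 ≤ (noiseMatrix ξ c ε ω ^ (2 * k)).trace := fun ω => by
    have hs : Matrix.transpose (noiseMatrix ξ c ε ω ^ k) = noiseMatrix ξ c ε ω ^ k := by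
      rw [Matrix.transpose_pow, (hsymm ω).eq]
    have := (Matrix.posSemidef_conjTranspose_mul_self (noiseMatrix ξ c ε ω ^ k)).trace_nonneg
    rwa [Matrix.conjTranspose_eq_transpose_of_trivial, hs, ← pow_add, ← two_mul] at this
  have hint : Integrable (fun ω => (noiseMatrix ξ c ε ω ^ (2 * k)).trace) P := by
    refine integrable_finsetSum _ fun u _ => ?_
    simpa using h.integrable_list_prod_mul_pow (c := c) (ε := ε) [] (2 * k) u u
  have hmarkov := mul_meas_ge_le_integral_of_nonneg (Filter.Eventually.of_forall hnn) hint
    (N ^ (2 * k))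
  have hNk : 0 < N ^ (2 * k) := by rw [pow_mul]; positivity
  refine (measureReal_mono hsub).trans ?_
  refine le_of_mul_le_mul_left (hmarkov.trans ?_) hNk
  calc _ ≤ _ := h.integral_trace_pow_le hinj hs hs0 hk1
    _ ≤ Real.exp L * (Real.exp (-3) * N ^ 2) ^ k := by gcongr
    _ = N ^ (2 * k) * Real.exp (L - 3 * k) := by
        rw [mul_pow, ← Real.exp_nat_mul, pow_mul, sub_eq_add_neg, Real.exp_add]
        rw [show (k : ℝ) * (-3) = -(3 * k) by ring]
        ring
    _ ≤ _ := by
        refine mul_le_mul_of_nonneg_left (Real.exp_le_exp.2 ?_) hNk.le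
        linarith

end Concentration

/-! ### Deterministic comparison of a feasible matrix with the true clusters. -/

section Deterministic

open scoped MatrixOrder Matrix.Norms.L2Operator in
theorem trace_mul_nonneg_of_posSemidef {V : Type*} [Fintype V] [DecidableEq V]
    {M N : Matrix V V ℝ} (hM : M.PosSemidef) (hN : N.PosSemidef) : 0 ≤ (M * N).trace := by
  obtain ⟨Y, rfl⟩ := CStarAlgebra.nonneg_iff_eq_star_mul_self.mp hN.nonneg
  rw [Matrix.star_eq_conjTranspose, ← Matrix.mul_assoc, Matrix.trace_mul_comm, ← Matrix.mul_assoc]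
  exact (hM.mul_mul_conjTranspose_same Y).trace_nonneg

variable {K m : ℕ}

theorem trueCluster_apply (i j : Node K m) :
    trueCluster K m i j = if i.1 = j.1 then 1 else 0 := by
  simp [trueCluster, Matrix.kronecker, Matrix.kroneckerMap_apply, Matrix.one_apply]

theorem mul_trueCluster_apply (M : Matrix (Node K m) (Node K m) ℝ) (i j : Node K m) :
    (M * trueCluster K m) i j = ∑ b, M i (j.1, b) := by
  simp only [Matrix.mul_apply, trueCluster_apply, Fintype.sum_prod_type]
  rw [Finset.sum_eq_single j.1] <;> simp +contextual

theorem trueCluster_mul_apply (M : Matrix (Node K m) (Node K m) ℝ) (i j : Node K m) :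
    (trueCluster K m * M) i j = ∑ b, M (i.1, b) j := by
  simp only [Matrix.mul_apply, trueCluster_apply, Fintype.sum_prod_type]
  rw [Finset.sum_eq_single i.1]
  · simp
  · intro b _ hb; simp [hb.symm]
  · simp

theorem trace_ones_mul (X : Matrix (Node K m) (Node K m) ℝ) :
    (Matrix.of (fun (_ _ : Node K m) => (1 : ℝ)) * X).trace = ∑ i, ∑ j, X j i := by
  simp [Matrix.trace, Matrix.mul_apply]

theorem transpose_trueCluster : (trueCluster K m).transpose = trueCluster K m := by
  ext i j
  simp [trueCluster_apply, eq_comm]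

theorem trueCluster_mul_self : trueCluster K m * trueCluster K m = (m : ℝ) • trueCluster K m := by
  ext i j
  by_cases h : i.1 = j.1 <;> simp [trueCluster_mul_apply, trueCluster_apply, h]

theorem posSemidef_trueCluster (hm : 1 ≤ m) : (trueCluster K m).PosSemidef := by
  have hm0 : (0 : ℝ) < m := by exact_mod_cast hm
  have h := (Matrix.posSemidef_conjTranspose_mul_self (trueCluster K m)).smul
    (inv_nonneg.2 hm0.le)
  rwa [Matrix.conjTranspose_eq_transpose_of_trivial, transpose_trueCluster, trueCluster_mul_self,
    smul_smul, inv_mul_cancel₀ hm0.ne', one_smul] at h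

theorem trueCluster_mem_sdp2Feasible (hK : 2 ≤ K) (hm : 1 ≤ m) :
    trueCluster K m ∈ sdp2Feasible K m := by
  have hK0 : (K : ℝ) ≠ 0 := by exact_mod_cast (by omega : K ≠ 0)
  refine ⟨?_, ?_, posSemidef_trueCluster hm, fun i j => ?_⟩
  · have h : ∀ i : Node K m, ∑ j, trueCluster K m j i = m := fun i => by
      simp only [trueCluster_apply, Fintype.sum_prod_type]
      rw [Finset.sum_comm]
      simp
    rw [trace_ones_mul]
    simp only [h, Finset.sum_const, Finset.card_univ, Fintype.card_prod, Fintype.card_fin,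
      nsmul_eq_mul, Nat.cast_mul]
    field_simp
  · ext i
    simp [trueCluster_apply]
  · rw [trueCluster_apply]; split_ifs <;> norm_num

variable {X : Matrix (Node K m) (Node K m) ℝ}

theorem le_one_of_mem_sdp2Feasible (hX : X ∈ sdp2Feasible K m) (i j : Node K m) : X i j ≤ 1 := by
  obtain ⟨-, hd, hpsd, -⟩ := hX
  have hdi : ∀ i, X i i = 1 := fun i => congrFun hd i
  have hs : X j i = X i j := by simpa using hpsd.isHermitian.apply i j
  have h := hpsd.dotProduct_mulVec_nonneg (Pi.single i 1 - Pi.single j 1)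
  simp [Matrix.mulVec_sub, sub_dotProduct, hdi, hs] at h
  linarith

/-- The total mass missing from the `k`-th diagonal block of `X`. -/
def blockDeficit (X : Matrix (Node K m) (Node K m) ℝ) (k : Fin K) : ℝ :=
  ∑ a, ∑ b, (1 - X (k, b) (k, a))

theorem blockDeficit_nonneg (hX : X ∈ sdp2Feasible K m) (k : Fin K) : 0 ≤ blockDeficit X k :=
  Finset.sum_nonneg fun _ _ => Finset.sum_nonneg fun _ _ =>
    sub_nonneg.2 (le_one_of_mem_sdp2Feasible hX _ _)

theorem sum_ite_block (f : Fin K → Fin m → Fin m → ℝ) :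
    (∑ i : Node K m, ∑ j : Node K m, if i.1 = j.1 then f i.1 i.2 j.2 else 0) =
      ∑ k, ∑ a, ∑ b, f k a b := by
  simp only [Fintype.sum_prod_type]
  refine Finset.sum_congr rfl fun k _ => Finset.sum_congr rfl fun a _ => ?_
  rw [Finset.sum_eq_single k]
  · simp
  · intro b _ hb; simp [hb.symm]
  · simp

/-- Since `X` and the true cluster matrix have equal total mass, what is missing inside the blocks
reappears outside. Everything can thus be expressed through the block deficits. -/
theorem sum_block_weights (hK : 2 ≤ K) (hX : X ∈ sdp2Feasible K m) (f : Fin K → ℝ) (g : ℝ) :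
    (∑ i : Node K m, ∑ j : Node K m,
      if i.1 = j.1 then f i.1 * (1 - X j i) else g * X j i) =
      ∑ k, (f k + g) * blockDeficit X k := by
  have hK0 : (K : ℝ) ≠ 0 := by exact_mod_cast (by omega : K ≠ 0)
  have htot : ∑ i, ∑ j, X j i = (m : ℝ) ^ 2 * K := by
    rw [← trace_ones_mul, hX.1]; field_simp
  have hin : ∀ h : Fin K → ℝ, (∑ i : Node K m, ∑ j : Node K m,
      if i.1 = j.1 then h i.1 * (1 - X j i) else 0) = ∑ k, h k * blockDeficit X k := by
    intro h
    have := sum_ite_block (m := m) fun k a b => h k * (1 - X (k, b) (k, a))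
    simp only [blockDeficit, Finset.mul_sum]
    rw [← this]
    refine Finset.sum_congr rfl fun i _ => Finset.sum_congr rfl fun j _ => ?_
    split_ifs with hij
    · rw [show ((i.1, j.2) : Node K m) = j from Prod.ext hij rfl]
    · rfl
  have hone : (∑ i : Node K m, ∑ j : Node K m, if i.1 = j.1 then (1 : ℝ) else 0) =
      (m : ℝ) ^ 2 * K := by
    rw [sum_ite_block fun _ _ _ => 1]
    simp
    ring
  have hsplit : ∀ i j : Node K m,
      (if i.1 = j.1 then f i.1 * (1 - X j i) else g * X j i) =
        (if i.1 = j.1 then (f i.1 + g) * (1 - X j i) else 0) + g * X j i -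
          g * (if i.1 = j.1 then (1 : ℝ) else 0) := by
    intro i j; split_ifs <;> ring
  simp only [hsplit, Finset.sum_sub_distrib, Finset.sum_add_distrib, ← Finset.mul_sum, htot, hone,
    hin fun k => f k + g]
  ring

theorem abs_trace_mul_sub_le (hK : 2 ≤ K) (hX : X ∈ sdp2Feasible K m)
    {M : Matrix (Node K m) (Node K m) ℝ} {f : Fin K → ℝ} {g : ℝ}
    (hM : ∀ i j, |M i j| ≤ if i.1 = j.1 then f i.1 else g) :
    |(M * (trueCluster K m - X)).trace| ≤ ∑ k, (f k + g) * blockDeficit X k := by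
  rw [← sum_block_weights hK hX]
  simp only [Matrix.trace, Matrix.diag_apply, Matrix.mul_apply]
  refine (Finset.abs_sum_le_sum_abs _ _).trans (Finset.sum_le_sum fun i _ =>
    (Finset.abs_sum_le_sum_abs _ _).trans (Finset.sum_le_sum fun j _ => ?_))
  have h := hM i j
  rw [abs_mul, Matrix.sub_apply, trueCluster_apply]
  by_cases hij : i.1 = j.1
  · rw [if_pos hij] at h ⊢
    rw [if_pos hij.symm, abs_of_nonneg (sub_nonneg.2 (le_one_of_mem_sdp2Feasible hX j i))]
    exact mul_le_mul_of_nonneg_right h (sub_nonneg.2 (le_one_of_mem_sdp2Feasible hX j i))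
  · rw [if_neg hij] at h ⊢
    rw [if_neg (Ne.symm hij), zero_sub, abs_neg, abs_of_nonneg (hX.2.2.2 j i)]
    exact mul_le_mul_of_nonneg_right h (hX.2.2.2 j i)

/-- A block-constant diagonal commutes with the projection `Q = 1 - X₀/m`, so one `Q` is absorbed in
the trace; with unit diagonal, the diagonal of `Q * X` consists of averaged deficits. -/
theorem trace_diagonal_mul_compl (hm : 1 ≤ m) (hX : X ∈ sdp2Feasible K m) (ν : Fin K → ℝ) :
    (Matrix.diagonal (fun i : Node K m => ν i.1) * ((1 - (m : ℝ)⁻¹ • trueCluster K m) * X *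
      (1 - (m : ℝ)⁻¹ • trueCluster K m))).trace = ∑ k, ν k / m * blockDeficit X k := by
  have hm0 : (m : ℝ) ≠ 0 := by exact_mod_cast (by omega : m ≠ 0)
  set Q : Matrix (Node K m) (Node K m) ℝ := 1 - (m : ℝ)⁻¹ • trueCluster K m with hQ
  set D := Matrix.diagonal (fun i : Node K m => ν i.1) with hD
  have hDT : D * trueCluster K m = trueCluster K m * D := by
    ext i j
    rw [hD, Matrix.diagonal_mul, Matrix.mul_diagonal, trueCluster_apply]
    split_ifs with h
    · rw [h]; ring
    · ring
  have hcomm : Q * D = D * Q := by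
    rw [hQ, sub_mul, mul_sub, one_mul, mul_one, Matrix.smul_mul, Matrix.mul_smul, hDT]
  have hQQ : Q * Q = Q := by
    have hTT : (m : ℝ)⁻¹ • trueCluster K m * (m : ℝ)⁻¹ • trueCluster K m =
        (m : ℝ)⁻¹ • trueCluster K m := by
      rw [Matrix.smul_mul, Matrix.mul_smul, trueCluster_mul_self, smul_smul, smul_smul, mul_assoc,
        inv_mul_cancel₀ hm0, mul_one]
    rw [hQ, sub_mul, one_mul, mul_sub, mul_one, hTT, sub_self, sub_zero]
  have h1 : (D * (Q * X * Q)).trace = (D * (Q * X)).trace := by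
    rw [← Matrix.mul_assoc, Matrix.trace_mul_comm, ← Matrix.mul_assoc, hcomm, Matrix.mul_assoc,
      ← Matrix.mul_assoc Q Q, hQQ]
  rw [h1]
  have hdi : ∀ i, X i i = 1 := fun i => congrFun hX.2.1 i
  have h2 : ∀ i : Node K m, (D * (Q * X)) i i = ν i.1 / m * ∑ b, (1 - X (i.1, b) i) := by
    intro i
    rw [hD, Matrix.diagonal_mul, hQ, sub_mul, one_mul, Matrix.sub_apply, Matrix.smul_mul,
      Matrix.smul_apply, trueCluster_mul_apply, hdi, smul_eq_mul, Finset.sum_sub_distrib]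
    simp only [Finset.sum_const, Finset.card_univ, Fintype.card_fin, nsmul_eq_mul, mul_one]
    field_simp
  simp only [Matrix.trace, Matrix.diag_apply, h2, Fintype.sum_prod_type, blockDeficit,
    Finset.mul_sum]

theorem abs_average_le {f : Fin m → ℝ} {t : ℝ} (hm : 1 ≤ m) (h : ∀ a, |f a| ≤ t) :
    |(m : ℝ)⁻¹ * ∑ a, f a| ≤ t := by
  have hm0 : (0 : ℝ) < m := by exact_mod_cast hm
  rw [abs_mul, abs_of_pos (inv_pos.2 hm0), inv_mul_le_iff₀ hm0]
  calc _ ≤ ∑ a, |f a| := Finset.abs_sum_le_sum_abs _ _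
    _ ≤ ∑ _a : Fin m, t := Finset.sum_le_sum fun a _ => h a
    _ = _ := by simp

/-- The noise `W` tested against `X₀ - X` is at most of the order of the block deficits of `X`. -/
theorem neg_le_trace_noise_mul_sub (hK : 2 ≤ K) (hm : 1 ≤ m) (hX : X ∈ sdp2Feasible K m)
    {W : Matrix (Node K m) (Node K m) ℝ} (hW : W.IsSymm) {N : Fin K → ℝ} {R : ℝ}
    (hpsd : (Matrix.diagonal (fun i : Node K m => N i.1 + R) - W).PosSemidef)
    (hrow : ∀ i l, |∑ b, W i (l, b)| ≤ if i.1 = l then N i.1 else R) :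
    -∑ k, 4 * (N k + R) / m * blockDeficit X k ≤ (W * (trueCluster K m - X)).trace := by
  have hm0 : (0 : ℝ) < m := by exact_mod_cast hm
  set T : Matrix (Node K m) (Node K m) ℝ := (m : ℝ)⁻¹ • trueCluster K m with hT
  set Δ := trueCluster K m - X with hΔ
  have hTt : T.transpose = T := by rw [hT, Matrix.transpose_smul, transpose_trueCluster]
  have hTX0 : T * trueCluster K m = trueCluster K m := by
    rw [hT, Matrix.smul_mul, trueCluster_mul_self, smul_smul, inv_mul_cancel₀ hm0.ne', one_smul]
  have hWT : ∀ i j : Node K m, |(W * T) i j| ≤ if i.1 = j.1 then N i.1 / m else R / m := by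
    intro i j
    have := hrow i j.1
    rw [hT, Matrix.mul_smul, Matrix.smul_apply, mul_trueCluster_apply, smul_eq_mul, abs_mul,
      abs_of_pos (inv_pos.2 hm0), inv_mul_le_iff₀ hm0]
    refine this.trans (le_of_eq ?_)
    split_ifs <;> field_simp
  have hTW : ∀ i j : Node K m, |(T * W) i j| ≤ if i.1 = j.1 then N i.1 / m else R / m := by
    intro i j
    have h1 : (T * W) i j = (W * T) j i := by
      rw [← Matrix.transpose_apply (W * T), Matrix.transpose_mul, hTt, hW.eq]
    rw [h1]
    refine (hWT j i).trans (le_of_eq ?_)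
    by_cases h : i.1 = j.1
    · simp [h]
    · simp [h, Ne.symm h]
  have hTWT : ∀ i j : Node K m,
      |(T * (W * T)) i j| ≤ if i.1 = j.1 then N i.1 / m else R / m := by
    intro i j
    rw [hT, Matrix.smul_mul, Matrix.smul_apply, trueCluster_mul_apply, smul_eq_mul]
    exact abs_average_le hm fun a => hWT (i.1, a) j
  have e1 := abs_trace_mul_sub_le (f := fun k => N k / m) hK hX hWT
  have e2 := abs_trace_mul_sub_le (f := fun k => N k / m) hK hX hTW
  have e3 := abs_trace_mul_sub_le (f := fun k => N k / m) hK hX hTWT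
  rw [← hΔ] at e1 e2 e3
  have hpsdX : ((1 - T) * X * (1 - T)).PosSemidef := by
    have := hX.2.2.1.mul_mul_conjTranspose_same (1 - T)
    rwa [Matrix.conjTranspose_eq_transpose_of_trivial, Matrix.transpose_sub, hTt,
      Matrix.transpose_one] at this
  have e4 := trace_mul_nonneg_of_posSemidef hpsd hpsdX
  rw [sub_mul, Matrix.trace_sub, hT, trace_diagonal_mul_compl hm hX (fun k => N k + R), ← hT] at e4
  -- Only the fully complementary part needs the spectral bound, and there `X₀` disappears because
  -- `T` fixes it. The three other terms and this one account for the factor 4.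
  have hdecomp : (W * Δ).trace = (W * T * Δ).trace + (T * W * Δ).trace -
      (T * (W * T) * Δ).trace - (W * ((1 - T) * X * (1 - T))).trace := by
    have h1 : W * Δ = W * T * Δ + W * Δ * T - W * T * Δ * T + W * ((1 - T) * Δ * (1 - T)) := by
      noncomm_ring
    have h2 : (1 - T) * Δ * (1 - T) = -((1 - T) * X * (1 - T)) := by
      rw [hΔ, mul_sub (1 - T), sub_mul 1 T (trueCluster K m), hTX0, one_mul, sub_self, zero_sub,
        neg_mul]
    rw [h2] at h1
    have h3 : (W * Δ * T).trace = (T * W * Δ).trace := by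
      rw [Matrix.trace_mul_comm, ← Matrix.mul_assoc]
    have h4 : (W * T * Δ * T).trace = (T * (W * T) * Δ).trace := by
      rw [Matrix.trace_mul_comm, ← Matrix.mul_assoc]
    rw [h1, Matrix.trace_add, Matrix.trace_sub, Matrix.trace_add, h3, h4, mul_neg,
      Matrix.trace_neg]
    ring
  have hsum : ∑ k, 4 * (N k + R) / m * blockDeficit X k =
      3 * (∑ k, (N k / m + R / m) * blockDeficit X k) +
        ∑ k, (N k + R) / m * blockDeficit X k := by
    rw [Finset.mul_sum, ← Finset.sum_add_distrib]
    refine Finset.sum_congr rfl fun k _ => ?_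
    ring
  rw [hdecomp, hsum]
  have a1 := (abs_le.1 e1).1
  have a2 := (abs_le.1 e2).1
  have a3 := (abs_le.1 e3).2
  linarith

theorem eq_trueCluster_of_blockDeficit_eq_zero (hK : 2 ≤ K) (hX : X ∈ sdp2Feasible K m)
    (h : ∀ k, blockDeficit X k = 0) : X = trueCluster K m := by
  have h1 := sum_block_weights hK hX (fun _ => 1) 1
  simp only [h, mul_zero, Finset.sum_const_zero, one_mul] at h1
  have hnn : ∀ i j : Node K m, 0 ≤ if i.1 = j.1 then 1 - X j i else X j i := by
    intro i j
    split_ifs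
    · exact sub_nonneg.2 (le_one_of_mem_sdp2Feasible hX j i)
    · exact hX.2.2.2 j i
  ext j i
  have h2 := (Finset.sum_eq_zero_iff_of_nonneg
    (fun i _ => Finset.sum_nonneg fun j _ => hnn i j)).1 h1 i (Finset.mem_univ _)
  have h3 := (Finset.sum_eq_zero_iff_of_nonneg (fun j _ => hnn i j)).1 h2 j (Finset.mem_univ _)
  rw [trueCluster_apply]
  by_cases hij : i.1 = j.1
  · rw [if_pos hij] at h3
    rw [if_pos hij.symm]; linarith
  · rw [if_neg hij] at h3
    rw [if_neg (Ne.symm hij), h3]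

/-- Deterministic recovery: `X₀` is the only solution when the noise is small against the gap. -/
theorem sdp2Solutions_eq_singleton (hK : 2 ≤ K) (hm : 1 ≤ m)
    {A W : Matrix (Node K m) (Node K m) ℝ} (hW : W.IsSymm) {Ψ : Matrix (Fin K) (Fin K) ℝ} {q : ℝ}
    (hA : ∀ i j, i ≠ j → A i j = Ψ i.1 j.1 + W i j)
    (hq : ∀ k l, k ≠ l → Ψ k l ≤ q) {N : Fin K → ℝ} {R : ℝ}
    (hpsd : (Matrix.diagonal (fun i : Node K m => N i.1 + R) - W).PosSemidef)
    (hrow : ∀ i l, |∑ b, W i (l, b)| ≤ if i.1 = l then N i.1 else R)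
    (hgap : ∀ k, 4 * (N k + R) < (Ψ k k - q) * m) :
    sdp2Solutions A = {trueCluster K m} := by
  have hm0 : (0 : ℝ) < m := by exact_mod_cast hm
  have hlow : ∀ X ∈ sdp2Feasible K m,
      ∑ k, (Ψ k k - q - 4 * (N k + R) / m) * blockDeficit X k ≤
        (A * trueCluster K m).trace - (A * X).trace := by
    intro X hX
    have hdi : ∀ i, X i i = 1 := fun i => congrFun hX.2.1 i
    have hn := neg_le_trace_noise_mul_sub hK hm hX hW hpsd hrow
    have hs := sum_block_weights hK hX (fun k => Ψ k k) (-q)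
    -- The unit diagonal kills the arbitrary diagonal of `A`. Outside the blocks `X₀ - X = -X ≤ 0`,
    -- so replacing `Ψ` by its upper bound `q` only lowers the sum.
    have hterm : (∑ i : Node K m, ∑ j : Node K m,
        if i.1 = j.1 then Ψ i.1 i.1 * (1 - X j i) else -q * X j i) +
          (W * (trueCluster K m - X)).trace ≤ (A * (trueCluster K m - X)).trace := by
      simp only [Matrix.trace, Matrix.diag_apply, Matrix.mul_apply]
      rw [← Finset.sum_add_distrib]
      refine Finset.sum_le_sum fun i _ => ?_
      rw [← Finset.sum_add_distrib]
      refine Finset.sum_le_sum fun j _ => ?_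
      rw [Matrix.sub_apply, trueCluster_apply]
      by_cases hij : i = j
      · subst hij
        simp [hdi]
      · rw [hA i j hij]
        by_cases hb : i.1 = j.1
        · rw [if_pos hb, if_pos hb.symm, hb]
          exact le_of_eq (by ring)
        · rw [if_neg hb, if_neg (Ne.symm hb)]
          have := mul_le_mul_of_nonneg_right (hq _ _ hb) (hX.2.2.2 j i)
          linarith
    rw [← Matrix.trace_sub, ← Matrix.mul_sub]
    refine le_trans (le_of_eq ?_) ((add_le_add hs.ge hn).trans hterm)
    rw [← sub_eq_add_neg, ← Finset.sum_sub_distrib]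
    refine Finset.sum_congr rfl fun k _ => ?_
    ring
  have hcoef : ∀ k, 0 < Ψ k k - q - 4 * (N k + R) / m := by
    intro k
    rw [sub_pos, div_lt_iff₀ hm0]
    exact hgap k
  have hX0 := trueCluster_mem_sdp2Feasible hK hm
  have hterm0 : ∀ X ∈ sdp2Feasible K m, ∀ k,
      0 ≤ (Ψ k k - q - 4 * (N k + R) / m) * blockDeficit X k :=
    fun X hX k => mul_nonneg (hcoef k).le (blockDeficit_nonneg hX k)
  refine Set.eq_singleton_iff_unique_mem.2 ⟨⟨hX0, fun X hX => ?_⟩, fun X hX => ?_⟩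
  · have := (Finset.sum_nonneg fun k _ => hterm0 X hX k).trans (hlow X hX)
    linarith
  · have h1 := hlow X hX.1
    have h2 := hX.2 _ hX0
    refine eq_trueCluster_of_blockDeficit_eq_zero hK hX.1 fun k => ?_
    have h3 : ∑ k, (Ψ k k - q - 4 * (N k + R) / m) * blockDeficit X k = 0 :=
      le_antisymm (by linarith) (Finset.sum_nonneg fun k _ => hterm0 X hX.1 k)
    have h4 := (Finset.sum_eq_zero_iff_of_nonneg fun k _ => hterm0 X hX.1 k).1 h3 k
      (Finset.mem_univ _)
    exact (mul_eq_zero.1 h4).resolve_left (hcoef k).ne'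

end Deterministic

/-! ### The block model as centred noise, and the union bound. -/

section Model

variable {K m : ℕ}

/-- The pairs of nodes that carry the independent entries of the adjacency matrix. -/
abbrev Edge (K m : ℕ) : Type :=
  {e : Node K m × Node K m // toLex e.1 < toLex e.2}

theorem Edge.ne (e : Edge K m) : e.1.1 ≠ e.1.2 :=
  fun h => e.2.ne (congrArg toLex h)

/-- The edge joining two nodes (an arbitrary one if they coincide). -/
def edgeBetween (e₀ : Edge K m) (u v : Node K m) : Edge K m :=
  if h : toLex u < toLex v then ⟨(u, v), h⟩
  else if h : toLex v < toLex u then ⟨(v, u), h⟩ else e₀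

theorem edgeBetween_comm (e₀ : Edge K m) (u v : Node K m) :
    edgeBetween e₀ u v = edgeBetween e₀ v u := by
  unfold edgeBetween
  by_cases h1 : toLex u < toLex v
  · simp [h1, h1.not_gt]
  · by_cases h2 : toLex v < toLex u <;> simp [h1, h2]

theorem edgeBetween_spec (e₀ : Edge K m) {u v : Node K m} (h : u ≠ v) :
    (edgeBetween e₀ u v).1 = (u, v) ∨ (edgeBetween e₀ u v).1 = (v, u) := by
  unfold edgeBetween
  rcases lt_or_gt_of_ne (fun h' => h (toLex.injective h') : toLex u ≠ toLex v) with h1 | h1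
  · left; simp [h1]
  · right; simp [h1, h1.not_gt]

theorem edgeBetween_injective (e₀ : Edge K m) {u v w : Node K m} (hv : u ≠ v) (hw : u ≠ w)
    (h : edgeBetween e₀ u v = edgeBetween e₀ u w) : v = w := by
  have h' := congrArg Subtype.val h
  rcases edgeBetween_spec e₀ hv with h1 | h1 <;> rcases edgeBetween_spec e₀ hw with h2 | h2 <;>
    rw [h1, h2, Prod.mk.injEq] at h'
  · exact h'.2
  · exact absurd h'.1 hw
  · exact absurd h'.1.symm hv
  · exact h'.1

/-- The matrix `A - 𝔼 A` off the diagonal, and `0` on it. -/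
def centered (Ψ : Matrix (Fin K) (Fin K) ℝ) (A : Matrix (Node K m) (Node K m) ℝ) :
    Matrix (Node K m) (Node K m) ℝ :=
  Matrix.of fun u v => if u = v then 0 else A u v - Ψ u.1 v.1

theorem isSymm_centered {Ψ : Matrix (Fin K) (Fin K) ℝ} (hΨ : Ψ.IsSymm)
    {A : Matrix (Node K m) (Node K m) ℝ} (hA : A.IsSymm) : (centered Ψ A).IsSymm := by
  refine Matrix.IsSymm.ext fun u v => ?_
  simp only [centered, Matrix.of_apply, eq_comm (a := v), hA.apply u v, hΨ.apply u.1 v.1]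

/-- The quadratic forms of the diagonal blocks and of the off-block part add up. Separate levels `N
k` keep a dense community from spoiling the gap condition of a sparse one. -/
theorem posSemidef_diagonal_sub_of_blocks {W : Matrix (Node K m) (Node K m) ℝ} (hW : W.IsSymm)
    {N : Fin K → ℝ} {R : ℝ}
    (hin : ∀ k, (N k • (1 : Matrix (Fin m) (Fin m) ℝ) -
      Matrix.of fun a b => W (k, a) (k, b)).PosSemidef)
    (hout : (R • (1 : Matrix (Node K m) (Node K m) ℝ) -
      Matrix.of fun u v => if u.1 ≠ v.1 then W u v else 0).PosSemidef) :
    (Matrix.diagonal (fun i : Node K m => N i.1 + R) - W).PosSemidef := by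
  refine Matrix.PosSemidef.of_dotProduct_mulVec_nonneg ?_ fun x => ?_
  · simp only [Matrix.IsHermitian, Matrix.conjTranspose_eq_transpose_of_trivial,
      Matrix.transpose_sub, Matrix.diagonal_transpose, hW.eq]
  have h1 : 0 ≤ ∑ k, ∑ a, ∑ b, x (k, a) * ((N k • (1 : Matrix (Fin m) (Fin m) ℝ) -
      Matrix.of fun a b => W (k, a) (k, b)) a b * x (k, b)) := by
    refine Finset.sum_nonneg fun k _ => ?_
    have := (hin k).dotProduct_mulVec_nonneg fun a => x (k, a)
    simpa only [dotProduct, Matrix.mulVec, Finset.mul_sum, star_trivial] using this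
  have h2 := hout.dotProduct_mulVec_nonneg x
  simp only [dotProduct, Matrix.mulVec, Finset.mul_sum, star_trivial] at h2 ⊢
  rw [← sum_ite_block] at h1
  refine (add_nonneg h1 h2).trans (le_of_eq ?_)
  rw [← Finset.sum_add_distrib]
  refine Finset.sum_congr rfl fun i _ => ?_
  rw [← Finset.sum_add_distrib]
  refine Finset.sum_congr rfl fun j _ => ?_
  obtain ⟨k, a⟩ := i
  obtain ⟨l, b⟩ := j
  simp only [Matrix.sub_apply, Matrix.smul_apply, Matrix.of_apply, Matrix.diagonal_apply,
    Matrix.one_apply, Prod.mk.injEq, smul_eq_mul]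
  by_cases hkl : k = l
  · subst hkl
    by_cases hab : a = b
    · simp [hab]; ring
    · simp [hab]
  · simp [hkl]

variable {Ω : Type*} [MeasurableSpace Ω] {P : Measure Ω} [IsProbabilityMeasure P]
  {Ψ : Matrix (Fin K) (Fin K) ℝ} {A : Ω → Matrix (Node K m) (Node K m) ℝ}

/-- The centred entry of the adjacency matrix carried by an edge. -/
def edgeNoise (Ψ : Matrix (Fin K) (Fin K) ℝ) (A : Ω → Matrix (Node K m) (Node K m) ℝ)
    (e : Edge K m) (ω : Ω) : ℝ :=
  A ω e.1.1 e.1.2 - Ψ e.1.1.1 e.1.2.1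

theorem IsBalancedBlockModel.integral_entry (hA : IsBalancedBlockModel P Ψ A) {u v : Node K m}
    (h : u ≠ v) : ∫ ω, A ω u v ∂P = Ψ u.1 v.1 := by
  have h1 : (fun ω => A ω u v) = Set.indicator {ω | A ω u v = 1} 1 := by
    ext ω
    rcases hA.binary ω u v h with h0 | h0 <;> simp [Set.indicator, h0]
  have hs : MeasurableSet {ω | A ω u v = 1} := hA.measurable u v h (measurableSet_singleton 1)
  rw [h1, integral_indicator_one hs, hA.prob u v h]

theorem IsBalancedBlockModel.isCenteredNoise (hΨ : IsProbabilityMatrix Ψ)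
    (hA : IsBalancedBlockModel P Ψ A) :
    IsCenteredNoise P (edgeNoise Ψ A) (fun e : Edge K m => Ψ e.1.1.1 e.1.2.1) := by
  have hint : ∀ e : Edge K m, Integrable (fun ω => A ω e.1.1 e.1.2) P := fun e =>
    integrable_of_abs_le (hA.measurable _ _ e.ne) 1 fun ω => by
      rcases hA.binary ω _ _ e.ne with h | h <;> simp [h]
  refine ⟨fun e => (hA.measurable _ _ e.ne).sub_const _, ?_, fun e ω => ?_, fun e => ?_,
    fun e => ?_⟩
  · exact hA.indep.comp (fun e x => x - Ψ e.1.1.1 e.1.2.1) fun e => measurable_sub_const _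
  · have := hΨ.mem_Icc e.1.1.1 e.1.2.1
    unfold edgeNoise
    rw [abs_le]
    rcases hA.binary ω _ _ e.ne with h | h <;> rw [h] <;> constructor <;> linarith [this.1, this.2]
  · unfold edgeNoise
    rw [integral_sub (hint e) (integrable_const _), hA.integral_entry e.ne]
    simp
  · have hsq : ∀ ω, edgeNoise Ψ A e ω ^ 2 =
        (1 - 2 * Ψ e.1.1.1 e.1.2.1) * A ω e.1.1 e.1.2 + Ψ e.1.1.1 e.1.2.1 ^ 2 := by
      intro ω
      unfold edgeNoise
      rcases hA.binary ω _ _ e.ne with h | h <;> rw [h] <;> ring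
    simp only [hsq]
    rw [integral_add ((hint e).const_mul _) (integrable_const _), integral_const_mul,
      hA.integral_entry e.ne]
    simp only [integral_const, probReal_univ, smul_eq_mul, one_mul]
    nlinarith [sq_nonneg (Ψ e.1.1.1 e.1.2.1)]

theorem edgeNoise_edgeBetween (hΨ : Ψ.IsSymm) (hA : ∀ ω, (A ω).IsSymm) (e₀ : Edge K m)
    {u v : Node K m} (h : u ≠ v) (ω : Ω) :
    edgeNoise Ψ A (edgeBetween e₀ u v) ω = centered Ψ (A ω) u v := by
  unfold edgeNoise
  simp only [centered, Matrix.of_apply, if_neg h]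
  rcases edgeBetween_spec e₀ h with h1 | h1 <;> rw [h1]
  rw [(hA ω).apply u v, hΨ.apply u.1 v.1]

theorem edgeBetween_prob (hΨ : Ψ.IsSymm) (e₀ : Edge K m) {u v : Node K m} (h : u ≠ v) :
    Ψ (edgeBetween e₀ u v).1.1.1 (edgeBetween e₀ u v).1.2.1 = Ψ u.1 v.1 := by
  rcases edgeBetween_spec e₀ h with h1 | h1 <;> rw [h1]
  exact hΨ.apply u.1 v.1

theorem measureReal_not_posSemidef_block_le (hΨ : IsProbabilityMatrix Ψ)
    (hA : IsBalancedBlockModel P Ψ A) (e₀ : Edge K m) {L : ℝ} (hL : 2 / 3 ≤ L)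
    (hm : (m : ℝ) ≤ Real.exp L) (k : Fin K) :
    P.real {ω | ¬ (noiseLevel (m * Ψ k k) L • (1 : Matrix (Fin m) (Fin m) ℝ) -
      Matrix.of fun a b => centered Ψ (A ω) (k, a) (k, b)).PosSemidef} ≤
      Real.exp (-(2 * L)) := by
  have hne : ∀ {a b : Fin m}, a ≠ b → ((k, a) : Node K m) ≠ (k, b) := fun h h' =>
    h (Prod.mk.inj h').2
  have hmat : ∀ ω, (Matrix.of fun a b => centered Ψ (A ω) (k, a) (k, b)) =
      noiseMatrix (edgeNoise Ψ A) (fun a b : Fin m => a ≠ b)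
        (fun a b => edgeBetween e₀ (k, a) (k, b)) ω := by
    intro ω
    ext a b
    simp only [noiseMatrix, Matrix.of_apply]
    by_cases hab : a = b
    · simp [hab, centered]
    · rw [if_pos hab, edgeNoise_edgeBetween hΨ.symm hA.symm e₀ (hne hab)]
  simp only [hmat]
  refine (hA.isCenteredNoise hΨ).measureReal_not_posSemidef_le ?_ (fun _ _ => ne_comm)
    (fun _ _ => edgeBetween_comm _ _ _) ?_ ?_ hL (by simpa using hm)
  · intro u v w huv huw h
    exact (Prod.mk.inj (edgeBetween_injective e₀ (hne huv) (hne huw) h)).2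
  · intro a
    calc _ ≤ ∑ _b : Fin m, Ψ k k := by
          refine Finset.sum_le_sum fun b _ => ?_
          split_ifs with hab
          · rw [edgeBetween_prob hΨ.symm e₀ (hne hab)]
          · exact (hΨ.mem_Icc k k).1
      _ = _ := by simp
  · exact mul_nonneg (Nat.cast_nonneg m) (hΨ.mem_Icc k k).1

theorem measureReal_not_posSemidef_offBlock_le (hΨ : IsProbabilityMatrix Ψ)
    (hA : IsBalancedBlockModel P Ψ A) (e₀ : Edge K m) {q : ℝ} (hq0 : 0 ≤ q)
    (hq : ∀ k l, k ≠ l → Ψ k l ≤ q) {L : ℝ} (hL : 2 / 3 ≤ L)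
    (hn : (m : ℝ) * K ≤ Real.exp L) :
    P.real {ω | ¬ (noiseLevel (m * K * q) L • (1 : Matrix (Node K m) (Node K m) ℝ) -
      Matrix.of fun u v => if u.1 ≠ v.1 then centered Ψ (A ω) u v else 0).PosSemidef} ≤
      Real.exp (-(2 * L)) := by
  have hne : ∀ {u v : Node K m}, u.1 ≠ v.1 → u ≠ v := fun h h' => h (congrArg Prod.fst h')
  have hmat : ∀ ω, (Matrix.of fun u v : Node K m =>
      if u.1 ≠ v.1 then centered Ψ (A ω) u v else 0) =
      noiseMatrix (edgeNoise Ψ A) (fun u v : Node K m => u.1 ≠ v.1) (edgeBetween e₀) ω := by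
    intro ω
    ext u v
    simp only [noiseMatrix, Matrix.of_apply]
    by_cases huv : u.1 = v.1
    · simp [huv]
    · rw [if_pos huv, if_pos huv, edgeNoise_edgeBetween hΨ.symm hA.symm e₀ (hne huv)]
  simp only [hmat]
  refine (hA.isCenteredNoise hΨ).measureReal_not_posSemidef_le ?_ (fun _ _ => ne_comm)
    (fun _ _ => edgeBetween_comm _ _ _) ?_ (by positivity) hL ?_
  · intro u v w huv huw h
    exact edgeBetween_injective e₀ (hne huv) (hne huw) h
  · intro u
    calc _ ≤ ∑ _v : Node K m, q := by
          refine Finset.sum_le_sum fun v _ => ?_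
          split_ifs with huv
          · rw [edgeBetween_prob hΨ.symm e₀ (hne huv)]
            exact hq _ _ huv
          · exact hq0
      _ = _ := by simp [mul_comm (K : ℝ)]
  · rw [Fintype.card_prod, Fintype.card_fin, Fintype.card_fin]
    push_cast
    linarith

theorem measureReal_abs_rowSum_gt_le (hΨ : IsProbabilityMatrix Ψ)
    (hA : IsBalancedBlockModel P Ψ A) (e₀ : Edge K m) {s L : ℝ} (hL : 0 < L) (i : Node K m)
    (l : Fin K) (hs : m * Ψ i.1 l ≤ s) :
    P.real {ω | ¬ |∑ b, centered Ψ (A ω) i (l, b)| ≤ noiseLevel s L} ≤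
      2 * Real.exp (-(3 * L)) := by
  set T : Finset (Fin m) := Finset.univ.filter fun b => i ≠ (l, b) with hT
  have hTmem : ∀ b ∈ T, i ≠ (l, b) := fun b hb => by simpa [hT] using hb
  have hinj : Set.InjOn (fun b => edgeBetween e₀ i (l, b)) T := fun b hb b' hb' h =>
    (Prod.mk.inj (edgeBetween_injective e₀ (hTmem b hb) (hTmem b' hb') h)).2
  have hsum : ∀ ω, ∑ b, centered Ψ (A ω) i (l, b) =
      ∑ e ∈ T.image fun b => edgeBetween e₀ i (l, b), edgeNoise Ψ A e ω := by
    intro ω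
    rw [Finset.sum_image hinj]
    rw [← Finset.sum_subset (Finset.subset_univ T)]
    · exact Finset.sum_congr rfl fun b hb =>
        (edgeNoise_edgeBetween hΨ.symm hA.symm e₀ (hTmem b hb) ω).symm
    · intro b _ hb
      have : i = (l, b) := by simpa [hT] using hb
      simp [centered, this]
  simp only [hsum]
  refine (hA.isCenteredNoise hΨ).measureReal_abs_sum_gt_le hL ?_
  rw [Finset.sum_image hinj]
  refine le_trans ?_ hs
  calc _ = ∑ _b ∈ T, Ψ i.1 l := Finset.sum_congr rfl fun b hb => by
        rw [edgeBetween_prob hΨ.symm e₀ (hTmem b hb)]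
    _ ≤ ∑ _b : Fin m, Ψ i.1 l := Finset.sum_le_sum_of_subset_of_nonneg (Finset.subset_univ T)
        fun _ _ _ => (hΨ.mem_Icc _ _).1
    _ = _ := by simp

theorem measureReal_iUnion_le_card_mul {κ : Type*} [Fintype κ] {s : κ → Set Ω} {t : ℝ}
    (h : ∀ i, P.real (s i) ≤ t) : P.real (⋃ i, s i) ≤ Fintype.card κ * t := by
  refine (measureReal_iUnion_fintype_le s).trans ((Finset.sum_le_sum fun i _ => h i).trans ?_)
  simp

/-- Transfers the gap from the minimal density `p` to a block of density `x ≥ p`: the hypothesis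
forces `√p ≥ 1000`, beyond which `x - 1000√x` is increasing. Here 240 is 4 times the 60 of
`noiseLevel`, and the slack absorbs the `+ 1` terms. -/
theorem sqrt_gap {p x y z C : ℝ} (hp : 1 ≤ p) (hpx : p ≤ x) (hy : 0 ≤ y) (hz : 0 ≤ z)
    (hC : 1000 ≤ C) (h : C * (Real.sqrt p + Real.sqrt z) < p - y) :
    240 * (Real.sqrt (x + 1) + Real.sqrt (z + 1)) < x - y := by
  have hx : 0 ≤ x := by linarith
  have hsx : Real.sqrt (x + 1) ≤ Real.sqrt x + 1 := by
    rw [Real.sqrt_le_left (by positivity)]; nlinarith [Real.sq_sqrt hx, Real.sqrt_nonneg x]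
  have hsz : Real.sqrt (z + 1) ≤ Real.sqrt z + 1 := by
    rw [Real.sqrt_le_left (by positivity)]; nlinarith [Real.sq_sqrt hz, Real.sqrt_nonneg z]
  have hp1 : 1 ≤ Real.sqrt p := Real.one_le_sqrt.2 hp
  have hz0 := Real.sqrt_nonneg z
  have hpx' : Real.sqrt p ≤ Real.sqrt x := Real.sqrt_le_sqrt hpx
  have hp2 : Real.sqrt p * Real.sqrt p = p := Real.mul_self_sqrt (by linarith)
  have hx2 : Real.sqrt x * Real.sqrt x = x := Real.mul_self_sqrt hx
  have h1 : 1000 * (Real.sqrt p + Real.sqrt z) < p - y :=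
    (mul_le_mul_of_nonneg_right hC (by linarith)).trans_lt h
  have h2 : 1000 ≤ Real.sqrt p := by
    by_contra! hlt
    nlinarith
  have h3 : 1000 * (Real.sqrt x - Real.sqrt p) ≤ x - p := by nlinarith
  linarith

theorem noiseLevel_eq {s L : ℝ} (hL : 0 < L) :
    noiseLevel s L = 60 * L * Real.sqrt (s / L + 1) := by
  rw [noiseLevel, show (s + L) * L = L ^ 2 * (s / L + 1) by field_simp,
    Real.sqrt_mul (by positivity), Real.sqrt_sq hL.le]
  ring

/-- Recovery fails with probability at most `4 / n` when the scaled gap dominates. -/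
theorem measureReal_recovery_ge (hK : 2 ≤ K) (hm : 1 ≤ m) (hΨ : IsProbabilityMatrix Ψ)
    (hA : IsBalancedBlockModel P Ψ A) {p q C : ℝ} (hq0 : 0 ≤ q)
    (hp : ∀ k, p ≤ Ψ k k) (hq : ∀ k l, k ≠ l → Ψ k l ≤ q) (hC : 1000 ≤ C)
    (hp1 : 1 ≤ rescale K m p)
    (hgap : C * (Real.sqrt (rescale K m p) + Real.sqrt (rescale K m q * K)) <
      rescale K m p - rescale K m q) :
    1 - 4 * ((m : ℝ) * K)⁻¹ ≤ P.real {ω | sdp2Solutions (A ω) = {trueCluster K m}} := by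
  have hm1 : (1 : ℝ) ≤ m := by exact_mod_cast hm
  have hK2 : (2 : ℝ) ≤ K := by exact_mod_cast hK
  set n : ℝ := (m : ℝ) * K with hn
  have hn2 : 2 ≤ n := by nlinarith
  have hn0 : 0 < n := by linarith
  set L := Real.log n with hLdef
  have hL : 2 / 3 ≤ L := by
    have h1 := Real.log_two_gt_d9
    have h2 : Real.log 2 ≤ L := Real.log_le_log (by norm_num) hn2
    linarith
  have hL0 : 0 < L := by linarith
  have hexpL : Real.exp L = n := Real.exp_log hn0
  have e₀ : Edge K m := ⟨((⟨0, by omega⟩, ⟨0, by omega⟩), (⟨1, by omega⟩, ⟨0, by omega⟩)), by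
    rw [Prod.Lex.toLex_lt_toLex]; left; simp [Fin.lt_def]⟩
  set N : Fin K → ℝ := fun k => noiseLevel (m * Ψ k k) L with hN
  set R : ℝ := noiseLevel (m * K * q) L with hR
  set B1 : Set Ω := ⋃ k : Fin K, {ω | ¬ (N k • (1 : Matrix (Fin m) (Fin m) ℝ) -
      Matrix.of fun a b => centered Ψ (A ω) (k, a) (k, b)).PosSemidef} with hB1
  set B2 : Set Ω := {ω | ¬ (R • (1 : Matrix (Node K m) (Node K m) ℝ) -
      Matrix.of fun u v => if u.1 ≠ v.1 then centered Ψ (A ω) u v else 0).PosSemidef} with hB2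
  set B3 : Set Ω := ⋃ x : Node K m × Fin K, {ω | ¬ |∑ b, centered Ψ (A ω) x.1 (x.2, b)| ≤
      if x.1.1 = x.2 then N x.1.1 else R} with hB3
  have hP1 : P.real B1 ≤ K * Real.exp (-(2 * L)) := by
    have := measureReal_iUnion_le_card_mul fun k =>
      measureReal_not_posSemidef_block_le hΨ hA e₀ hL (by rw [hexpL]; nlinarith) k
    simpa using this
  have hP2 : P.real B2 ≤ Real.exp (-(2 * L)) :=
    measureReal_not_posSemidef_offBlock_le hΨ hA e₀ hq0 hq hL hexpL.ge
  have hP3 : P.real B3 ≤ n * K * (2 * Real.exp (-(3 * L))) := by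
    have h : ∀ x : Node K m × Fin K, P.real {ω | ¬ |∑ b, centered Ψ (A ω) x.1 (x.2, b)| ≤
        if x.1.1 = x.2 then N x.1.1 else R} ≤ 2 * Real.exp (-(3 * L)) := by
      rintro ⟨i, l⟩
      by_cases hil : i.1 = l
      · simp only [hil, if_true]
        exact measureReal_abs_rowSum_gt_le hΨ hA e₀ hL0 i l (by rw [hil])
      · simp only [hil, if_false]
        refine measureReal_abs_rowSum_gt_le hΨ hA e₀ hL0 i l ?_
        -- Wasteful by a factor `K`, but `R` is already needed at this size for the spectrum.
        calc (m : ℝ) * Ψ i.1 l ≤ m * (1 * q) := by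
              rw [one_mul]; exact mul_le_mul_of_nonneg_left (hq _ _ hil) (by linarith)
          _ ≤ m * (K * q) := by gcongr; linarith
          _ = _ := by ring
    refine (measureReal_iUnion_le_card_mul h).trans (le_of_eq ?_)
    simp only [Fintype.card_prod, Fintype.card_fin, Nat.cast_mul, hn]
    ring
  have hcover : Set.univ ⊆ {ω | sdp2Solutions (A ω) = {trueCluster K m}} ∪ (B1 ∪ B2 ∪ B3) := by
    intro ω _
    by_cases hb : ω ∈ B1 ∪ B2 ∪ B3
    · exact Or.inr hb
    left
    simp only [Set.mem_union, not_or] at hb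
    obtain ⟨⟨hb1, hb2⟩, hb3⟩ := hb
    simp only [hB1, Set.mem_iUnion, Set.mem_ofPred_eq, not_exists, not_not] at hb1
    simp only [hB2, Set.mem_ofPred_eq, not_not] at hb2
    simp only [hB3, Set.mem_iUnion, Set.mem_ofPred_eq, not_exists, not_not] at hb3
    have hsymm := isSymm_centered hΨ.symm (hA.symm ω)
    refine sdp2Solutions_eq_singleton hK hm hsymm (fun i j hij => ?_) hq
      (posSemidef_diagonal_sub_of_blocks hsymm hb1 hb2) (fun i l => hb3 (i, l)) fun k => ?_
    · simp [centered, hij]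
    · have hpk : rescale K m p ≤ m * Ψ k k / L := by
        unfold rescale
        rw [mul_comm p]
        gcongr
        exact hp k
      have hy : 0 ≤ rescale K m q := by unfold rescale; positivity
      have hz : m * K * q / L = rescale K m q * K := by unfold rescale; ring
      have h := sqrt_gap hp1 hpk hy (by positivity) hC hgap
      have hdiff : (Ψ k k - q) * m = L * (m * Ψ k k / L - rescale K m q) := by
        unfold rescale
        rw [← hn, ← hLdef]
        field_simp
      rw [hdiff]
      simp only [hN, hR]
      rw [noiseLevel_eq hL0, noiseLevel_eq hL0, hz]
      calc _ = L * (240 * (Real.sqrt (m * Ψ k k / L + 1) +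
            Real.sqrt (rescale K m q * K + 1))) := by ring
        _ < _ := mul_lt_mul_of_pos_left h hL0
  have htotal : 1 ≤ P.real {ω | sdp2Solutions (A ω) = {trueCluster K m}} +
      (P.real B1 + P.real B2 + P.real B3) := by
    calc (1 : ℝ) = P.real Set.univ := probReal_univ.symm
      _ ≤ _ := measureReal_mono hcover
      _ ≤ _ := measureReal_union_le _ _
      _ ≤ _ := by
        gcongr
        refine (measureReal_union_le _ _).trans ?_
        gcongr
        exact measureReal_union_le _ _
  have hKn : (K : ℝ) ≤ n := by nlinarith
  have hinv : Real.exp (-L) = n⁻¹ := by rw [Real.exp_neg, hexpL]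
  have h2L : Real.exp (-(2 * L)) = n⁻¹ ^ 2 := by
    rw [← hinv, ← Real.exp_nat_mul]; congr 1; push_cast; ring
  have h3L : Real.exp (-(3 * L)) = n⁻¹ ^ 3 := by
    rw [← hinv, ← Real.exp_nat_mul]; congr 1; push_cast; ring
  have hi0 : 0 < n⁻¹ := inv_pos.2 hn0
  have hi1 : n⁻¹ ≤ 1 := inv_le_one_of_one_le₀ (by linarith)
  have hnn : n * n⁻¹ = 1 := mul_inv_cancel₀ hn0.ne'
  -- With `K ≤ n`, the three bad events cost `1/n`, `1/n` and `2/n`.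
  have b1 : (K : ℝ) * Real.exp (-(2 * L)) ≤ n⁻¹ := by
    rw [h2L]
    calc (K : ℝ) * n⁻¹ ^ 2 ≤ n * n⁻¹ ^ 2 := by gcongr
      _ = n⁻¹ := by rw [sq, ← mul_assoc, hnn, one_mul]
  have b2 : Real.exp (-(2 * L)) ≤ n⁻¹ := by
    rw [h2L, sq]
    exact mul_le_of_le_one_left hi0.le hi1
  have b3 : n * K * (2 * Real.exp (-(3 * L))) ≤ 2 * n⁻¹ := by
    rw [h3L]
    calc n * K * (2 * n⁻¹ ^ 3) ≤ n * n * (2 * n⁻¹ ^ 3) := by gcongr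
      _ = 2 * (n * n⁻¹) * (n * n⁻¹) * n⁻¹ := by ring
      _ = _ := by rw [hnn]; ring
  linarith

end Model

theorem diag_ge_pMinus {K : ℕ} (Ψ : Matrix (Fin K) (Fin K) ℝ) (k : Fin K) : pMinus Ψ ≤ Ψ k k :=
  ciInf_le (Set.finite_range _).bddBelow k

theorem offDiag_le_qPlus {K : ℕ} (Ψ : Matrix (Fin K) (Fin K) ℝ) {k l : Fin K} (h : k ≠ l) :
    Ψ k l ≤ qPlus Ψ :=
  le_ciSup (f := fun e : {e : Fin K × Fin K // e.1 ≠ e.2} => Ψ e.1.1 e.1.2)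
    (Set.finite_range _).bddAbove ⟨(k, l), h⟩

end BlockModel

end

theorem mainTheorem6 :
    ∃ C C' c r : ℝ, 0 < C ∧ 0 < C' ∧ 0 < c ∧ 0 < r ∧
      ∀ (K m : ℕ), 2 ≤ K → 1 ≤ m →
      ∀ (Ψ : Matrix (Fin K) (Fin K) ℝ),
        BlockModel.IsProbabilityMatrix Ψ → BlockModel.StronglyAssortative Ψ →
      ∀ {Ω : Type*} [MeasurableSpace Ω] (P : Measure Ω) [IsProbabilityMeasure P]
        (A : Ω → Matrix (BlockModel.Node K m) (BlockModel.Node K m) ℝ),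
        BlockModel.IsBalancedBlockModel P Ψ A →
      ∀ (c₁ c₂ : ℝ), 0 < c₁ → 0 < c₂ →
      ∀ (n C₁ C₂ pt qt : ℝ),
        n = (m : ℝ) * K →
        C₁ = max C' (4 / 9 * (c₁ + 1)) →
        C₂ = C + max (Real.sqrt (4 * (c₁ + 1))) (3 * Real.sqrt (4 * (c₂ + 1))) →
        pt = BlockModel.rescale K m (BlockModel.pMinus Ψ) →
        qt = BlockModel.rescale K m (BlockModel.qPlus Ψ) →
        C₁ ≤ pt →
        C₂ * (Real.sqrt pt + Real.sqrt (qt * K)) < pt - qt →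
        1 - c * ((K : ℝ) * (m : ℝ) ^ (-r) + n ^ (-r)) - n ^ (-c₁) - 2 * (m : ℝ)⁻¹ * n ^ (-c₂) ≤
          P.real {ω | BlockModel.sdp2Solutions (A ω) = {BlockModel.trueCluster K m}} := by
  -- `C = 1000` is what `sqrt_gap` requires, and `c = 4`, `r = 1` match the failure bound `4 / n`.
  -- The remaining subtracted terms are nonnegative and only weaken the claim.
  refine ⟨1000, 1, 4, 1, by norm_num, by norm_num, by norm_num, by norm_num, ?_⟩
  intro K m hK hm Ψ hΨ _ Ω _ P _ A hA c₁ c₂ _ _ n C₁ C₂ pt qt hn hC₁ hC₂ hpt hqt hCp hgap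
  have hq0 : 0 ≤ BlockModel.qPlus Ψ :=
    (hΨ.mem_Icc ⟨0, by omega⟩ ⟨1, by omega⟩).1.trans
      (BlockModel.offDiag_le_qPlus Ψ (by simp))
  have hC : (1000 : ℝ) ≤ C₂ := by
    rw [hC₂]
    exact le_add_of_nonneg_right (le_max_of_le_left (Real.sqrt_nonneg _))
  have hp1 : 1 ≤ BlockModel.rescale K m (BlockModel.pMinus Ψ) := by
    rw [← hpt]
    exact ((le_max_left _ _).trans hC₁.ge).trans hCp
  rw [hpt, hqt] at hgap
  have h := BlockModel.measureReal_recovery_ge hK hm hΨ hA hq0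
    (BlockModel.diag_ge_pMinus Ψ) (fun k l => BlockModel.offDiag_le_qPlus Ψ) hC hp1 hgap
  rw [← hn] at h
  have hn0 : 0 ≤ n := by rw [hn]; positivity
  have h1 : 0 ≤ (K : ℝ) * (m : ℝ) ^ (-1 : ℝ) := by positivity
  have h2 : n ^ (-1 : ℝ) = n⁻¹ := Real.rpow_neg_one n
  have h3 : 0 ≤ n ^ (-c₁) := Real.rpow_nonneg hn0 _
  have h4 : 0 ≤ 2 * (m : ℝ)⁻¹ * n ^ (-c₂) := by positivity
  rw [h2]
  linarith
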